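/- Let $(s_n)_{n\in\mathbb Z}$ be a two-sided sequence of positive integers. Let $\Gamma$ be the graph whose vertex set is the disjoint union $\bigcup_{n\in\mathbb Z}S_n$ with $|S_n|=s_n$, in which two vertices are adjacent if and only if they lie in consecutive sets $S_n$ and $S_{n+1}$ for some $n$; each edge $e$ is identified with $[0,1]$, oriented from $S_n$ to $S_{n+1}$. The Kirchhoff Laplacian $\mathbb H$ in $L^2(\Gamma)=\bigoplus_e L^2(e)$ is $\mathbb H f=-f''$, with domain the set of all $f\in\bigoplus_e H^2(e)$ that are continuous on $\Gamma$ and for which, at each vertex, the sum of the outgoing derivatives of $f$ along the incident edges is $0$. Put $\mu=\sum_{n\in\mathbb Z}s_ns_{n+1}\chi_{[n,n+1)}$ and $\tau f=-\frac1\mu(\mu f')'$. Let $H$ be the operator $f\mapsto\tau f$ in $L^2(\mathbb R;\mu)$ with domain $$\{f\in L^2(\mathbb R;\mu): f,\ \mu f'\in AC_{\mathrm{loc}}(\mathbb R),\ \tau f\in L^2(\mathbb R;\mu)\}.$$ For $n\in\mathbb Z$ let $H_n^1$ and $H_n^2$ be the operators $f\mapsto \tau f$ in $L^2(J;\mu)$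 with domain $$\{f\in L^2(J;\mu): f,\ \mu f'\in AC(J),\ \tau f\in L^2(J;\mu),\ f=0\text{ at both endpoints of }J\},$$ where $J=(n-1,n+1)$ for $H_n^1$ and $J=(n,n+1)$ for $H_n^2$. Then $H$ is self-adjoint, and $\mathbb H$ is unitarily equivalent to the Hilbert direct sum $$H\ \oplus\ \bigoplus_{n\in\mathbb Z}\bigoplus_{j=1}^{s_n-1}H_n^1\ \oplus\ \bigoplus_{n\in\mathbb Z}\bigoplus_{j=1}^{(s_n-1)(s_{n+1}-1)}H_n^2 .$$ -/

import Mathlib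

open MeasureTheory Set

/-! ### Unbounded operators: Hilbert direct sums and unitary equivalence -/

/-- Unitary equivalence of two (unbounded) operators: a unitary map `U` carries the domain of `A`
onto the domain of `B` and satisfies `U A x = B U x` there. -/
def UnitarilyEquivalent {E F : Type*} [NormedAddCommGroup E] [InnerProductSpace ℂ E]
    [NormedAddCommGroup F] [InnerProductSpace ℂ F]
    (A : E →ₗ.[ℂ] E) (B : F →ₗ.[ℂ] F) : Prop :=
  ∃ U : E ≃ₗᵢ[ℂ] F, (∀ x : E, x ∈ A.domain ↔ U x ∈ B.domain) ∧
    ∀ (x : A.domain) (y : B.domain), U (x : E) = (y : F) → U (A x) = B y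

/-- The graph of the Hilbert direct sum of the operators `A i`: pairs `(x, y)` of square summable
families with `x i ∈ dom (A i)` and `y i = A i (x i)` for every `i`. -/
def directSumGraph {ι : Type*} {E : ι → Type*} [∀ i, NormedAddCommGroup (E i)]
    [∀ i, InnerProductSpace ℂ (E i)] (A : ∀ i, E i →ₗ.[ℂ] E i) :
    Submodule ℂ (lp E 2 × lp E 2) where
  carrier := {q | ∀ i, (q.1 i, q.2 i) ∈ (A i).graph}
  add_mem' := fun ha hb i => (A i).graph.add_mem (ha i) (hb i)
  zero_mem' := fun i => (A i).graph.zero_mem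
  smul_mem' := fun c _ ha i => (A i).graph.smul_mem c (ha i)

theorem directSumGraph_singleValued {ι : Type*} {E : ι → Type*} [∀ i, NormedAddCommGroup (E i)]
    [∀ i, InnerProductSpace ℂ (E i)] (A : ∀ i, E i →ₗ.[ℂ] E i)
    (q : lp E 2 × lp E 2) (hq : q ∈ directSumGraph A) (h0 : q.1 = 0) : q.2 = 0 := by
  ext i
  have h := hq i
  rw [h0] at h
  simpa using (A i).graph_fst_eq_zero_snd h rfl

/-- The Hilbert direct sum `⨁ i, A i`, with domain
`{x ∈ ⨁ E i | x i ∈ dom (A i), ∑ ‖A i (x i)‖² < ∞}`. -/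
noncomputable def directSumOperator {ι : Type*} {E : ι → Type*} [∀ i, NormedAddCommGroup (E i)]
    [∀ i, InnerProductSpace ℂ (E i)] (A : ∀ i, E i →ₗ.[ℂ] E i) : lp E 2 →ₗ.[ℂ] lp E 2 :=
  (directSumGraph A).toLinearPMap

/-! ### Absolute continuity -/

/-- `u` is absolutely continuous on every compact subinterval of the closed interval `I`
(hence on `I` itself when `I` is compact), with derivative `u'` almost everywhere on `I`. -/
structure IsACWithDeriv (I : Set ℝ) (u u' : ℝ → ℂ) : Prop where
  ac : ∀ a ∈ I, ∀ b ∈ I, AbsolutelyContinuousOnInterval u a b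
  hasDeriv : ∀ᵐ x ∂(volume.restrict I), HasDerivAt u (u' x) x

namespace IsACWithDeriv

variable {I : Set ℝ} {u u' v v' : ℝ → ℂ}

theorem add (hu : IsACWithDeriv I u u') (hv : IsACWithDeriv I v v') :
    IsACWithDeriv I (u + v) (u' + v') where
  ac a ha b hb := (hu.ac a ha b hb).add (hv.ac a ha b hb)
  hasDeriv := by
    filter_upwards [hu.hasDeriv, hv.hasDeriv] with x h1 h2 using h1.add h2

theorem smul (c : ℂ) (hu : IsACWithDeriv I u u') : IsACWithDeriv I (c • u) (c • u') where
  ac a ha b hb := (hu.ac a ha b hb).const_smul c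
  hasDeriv := by
    filter_upwards [hu.hasDeriv] with x h1 using h1.const_smul c

theorem zero (I : Set ℝ) : IsACWithDeriv I 0 0 where
  ac a _ b _ := (contDiffOn_const (c := (0 : ℂ)) (s := uIcc a b)
    (n := 1) (𝕜 := ℝ)).absolutelyContinuousOnInterval
  hasDeriv := .of_forall fun x => hasDerivAt_const x (0 : ℂ)

/-- The derivative of an absolutely continuous function that vanishes a.e. vanishes a.e. -/
theorem deriv_ae_eq_zero (hI : Convex ℝ I) (hu : IsACWithDeriv I u u')
    (h0 : u =ᵐ[volume.restrict I] 0) : u' =ᵐ[volume.restrict I] 0 := by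
  have hcont : ContinuousOn u (interior I) := by
    intro x hx
    obtain ⟨ε, hε, hball⟩ := Metric.isOpen_iff.1 isOpen_interior x hx
    have hm : x - ε / 2 ∈ I := interior_subset (hball (by
      simp [abs_of_pos hε, hε]))
    have hp : x + ε / 2 ∈ I := interior_subset (hball (by
      simp [abs_of_pos hε, hε]))
    have := (hu.ac _ hm _ hp).continuousOn
    refine (this.continuousAt ?_).continuousWithinAt
    rw [uIcc_of_le (by linarith)]
    exact Icc_mem_nhds (by linarith) (by linarith)
  have hz : EqOn u 0 (interior I) := by
    refine Measure.eqOn_open_of_ae_eq (μ := volume) ?_ isOpen_interior hcont continuousOn_const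
    exact ae_restrict_of_ae_restrict_of_subset interior_subset h0
  have hint : ∀ᵐ x ∂(volume.restrict I), x ∈ interior I := by
    have hfr : volume (frontier I) = 0 := hI.addHaar_frontier volume
    have h1 : ∀ᵐ x ∂(volume.restrict I), x ∉ frontier I :=
      ae_restrict_of_ae (measure_eq_zero_iff_ae_notMem.1 hfr)
    have h2 : ∀ᵐ x ∂(volume.restrict I), x ∈ closure I :=
      ae_restrict_of_ae_restrict_of_subset subset_closure
        (ae_restrict_mem isClosed_closure.measurableSet)
    filter_upwards [h1, h2] with x hx1 hx2
    by_contra hx3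
    exact hx1 ⟨hx2, hx3⟩
  filter_upwards [hu.hasDeriv, hint] with x hx1 hx2
  have : u =ᶠ[nhds x] fun _ => 0 := by
    filter_upwards [isOpen_interior.mem_nhds hx2] with y hy using hz hy
  exact hx1.unique ((hasDerivAt_const x (0 : ℂ)).congr_of_eventuallyEq this)

end IsACWithDeriv

/-! ### Sturm–Liouville operators -/

/-- The measure `μ(x) dx` on `I`. -/
noncomputable def weightedMeasure (μ : ℝ → ℝ) (I : Set ℝ) : Measure ℝ :=
  (volume.restrict I).withDensity fun x => ENNReal.ofReal (μ x)

/-- The Hilbert space `L²(I; μ)`. -/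
abbrev WeightedL2 (μ : ℝ → ℝ) (I : Set ℝ) : Type := Lp ℂ 2 (weightedMeasure μ I)

/-- The graph of the operator `τ = -(1/μ) (d/dx) μ (d/dx)` in `L²(I; μ)` with Dirichlet conditions
on `B`: pairs `(f, g)` such that `f` and `μ f'` are absolutely continuous (they have representatives
`u` and `p` which are), `f = 0` on `B`, and `g = τ f`.  -/
def sturmLiouvilleGraph (μ : ℝ → ℝ) (I B : Set ℝ) :
    Submodule ℂ (WeightedL2 μ I × WeightedL2 μ I) where
  carrier := {q | ∃ u u' p p' : ℝ → ℂ,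
    IsACWithDeriv I u u' ∧ IsACWithDeriv I p p' ∧
    q.1 =ᵐ[weightedMeasure μ I] u ∧
    p =ᵐ[volume.restrict I] (fun x => (μ x : ℂ) * u' x) ∧
    q.2 =ᵐ[weightedMeasure μ I] (fun x => -(1 / (μ x : ℂ)) * p' x) ∧
    ∀ x ∈ B, u x = 0}
  add_mem' := by
    rintro ⟨f, g⟩ ⟨f₂, g₂⟩ ⟨u, u', p, p', hu, hp, hf, hpu, hg, hB⟩
      ⟨v, v', r, r', hv, hr, hf₂, hrv, hg₂, hB₂⟩
    refine ⟨u + v, u' + v', p + r, p' + r', hu.add hv, hp.add hr, ?_, ?_, ?_, ?_⟩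
    · exact (Lp.coeFn_add f f₂).trans (hf.add hf₂)
    · filter_upwards [hpu, hrv] with x h1 h2
      simp only [Pi.add_apply, h1, h2]; ring
    · filter_upwards [Lp.coeFn_add g g₂, hg, hg₂] with x h0 h1 h2
      simp only [Prod.mk_add_mk, h0, Pi.add_apply, h1, h2]; ring
    · intro x hx
      simp [hB x hx, hB₂ x hx]
  zero_mem' := by
    refine ⟨0, 0, 0, 0, .zero I, .zero I, Lp.coeFn_zero _ _ _, ?_, ?_, fun _ _ => rfl⟩
    · exact .of_forall fun x => by simp
    · filter_upwards [Lp.coeFn_zero ℂ 2 (weightedMeasure μ I)] with x h0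
      simpa using h0
  smul_mem' := by
    rintro c ⟨f, g⟩ ⟨u, u', p, p', hu, hp, hf, hpu, hg, hB⟩
    refine ⟨c • u, c • u', c • p, c • p', hu.smul c, hp.smul c, ?_, ?_, ?_, ?_⟩
    · exact (Lp.coeFn_smul c f).trans (hf.const_smul c)
    · filter_upwards [hpu] with x h1
      simp only [Pi.smul_apply, h1, smul_eq_mul]; ring
    · filter_upwards [Lp.coeFn_smul c g, hg] with x h0 h1
      simp only [Prod.smul_mk, h0, Pi.smul_apply, h1, smul_eq_mul]; ring
    · intro x hx
      simp [hB x hx]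

/-- For a positive weight the graph is single-valued, i.e. it is the graph of an operator. -/
theorem sturmLiouvilleGraph_singleValued {μ : ℝ → ℝ} (hμm : Measurable μ) (hμ : ∀ x, 0 < μ x)
    {I : Set ℝ} (hI : Convex ℝ I) (B : Set ℝ)
    (q : WeightedL2 μ I × WeightedL2 μ I) (hq : q ∈ sturmLiouvilleGraph μ I B)
    (h0 : q.1 = 0) : q.2 = 0 := by
  obtain ⟨u, u', p, p', hu, hp, hf, hpu, hg, -⟩ := hq
  have hac : volume.restrict I ≪ weightedMeasure μ I :=
    withDensity_absolutelyContinuous' (by fun_prop)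
      (.of_forall fun x => (ENNReal.ofReal_pos.2 (hμ x)).ne')
  have hac' : weightedMeasure μ I ≪ volume.restrict I := withDensity_absolutelyContinuous _ _
  have hu0 : u =ᵐ[volume.restrict I] 0 := by
    refine hac.ae_le (hf.symm.trans ?_)
    rw [h0]; exact Lp.coeFn_zero _ _ _
  have hu'0 := hu.deriv_ae_eq_zero hI hu0
  have hp0 : p =ᵐ[volume.restrict I] 0 := by
    filter_upwards [hpu, hu'0] with x h1 h2
    simp [h1, h2]
  have hp'0 := hac'.ae_le (hp.deriv_ae_eq_zero hI hp0)
  refine (Lp.eq_zero_iff_ae_eq_zero).2 ?_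
  filter_upwards [hg, hp'0] with x h1 h2
  simp [h1, h2]

/-- The realization of `τ = -(1/μ) (d/dx) μ (d/dx)` in `L²(I; μ)` with domain
`{f ∈ L²(I; μ) | f, μ f' ∈ AC, τ f ∈ L²(I; μ), f = 0 on B}`. -/
noncomputable def sturmLiouville (μ : ℝ → ℝ) (I B : Set ℝ) :
    WeightedL2 μ I →ₗ.[ℂ] WeightedL2 μ I :=
  (sturmLiouvilleGraph μ I B).toLinearPMap

/-! ### The Kirchhoff Laplacian of an equilateral metric graph -/

/-- The Hilbert space `L²(Γ) = ⨁ₑ L²(e)` of a metric graph whose edges `e` all are copies of the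
unit interval. -/
abbrev GraphL2 (E : Type) : Type :=
  lp (fun _ : E => Lp ℂ 2 (volume.restrict (Icc (0 : ℝ) 1))) 2

/-- The graph of the Kirchhoff Laplacian of the locally finite metric graph with vertices `V` and
edges `E`, where the edge `e` is a copy of `[0, 1]` whose endpoints `0` and `1` are the vertices
`src e` and `tgt e`. A pair `(f, g)` belongs to it if `f` lies in `⨁ₑ H²(e)` (on each edge `f` and
`f'` are absolutely continuous, and `f`, `f'`, `f''` lie in `L²(Γ)`), `f` is continuous at the
vertices (with value `F v` at `v`), the sum of the outgoing derivatives vanishes at each vertex, and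
`g = -f''`. -/
def kirchhoffGraph {V E : Type} (src tgt : E → V) (hsrc : ∀ v, {e | src e = v}.Finite)
    (htgt : ∀ v, {e | tgt e = v}.Finite) : Submodule ℂ (GraphL2 E × GraphL2 E) where
  carrier := {q | ∃ (u u' u'' : E → ℝ → ℂ) (F : V → ℂ) (h : GraphL2 E),
    (∀ e, IsACWithDeriv (Icc 0 1) (u e) (u' e)) ∧
    (∀ e, IsACWithDeriv (Icc 0 1) (u' e) (u'' e)) ∧
    (∀ e, q.1 e =ᵐ[volume.restrict (Icc 0 1)] u e) ∧
    (∀ e, h e =ᵐ[volume.restrict (Icc 0 1)] u' e) ∧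
    (∀ e, q.2 e =ᵐ[volume.restrict (Icc 0 1)] -u'' e) ∧
    (∀ e, u e 0 = F (src e) ∧ u e 1 = F (tgt e)) ∧
    ∀ v, (∑ e ∈ (hsrc v).toFinset, u' e 0) + (∑ e ∈ (htgt v).toFinset, -u' e 1) = 0}
  add_mem' := by
    rintro ⟨f, g⟩ ⟨f₂, g₂⟩ ⟨u, u', u'', F, h, h1, h2, h3, h4, h5, h6, h7⟩
      ⟨v, v', v'', F₂, k, k1, k2, k3, k4, k5, k6, k7⟩
    refine ⟨u + v, u' + v', u'' + v'', F + F₂, h + k, fun e => (h1 e).add (k1 e),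
      fun e => (h2 e).add (k2 e), fun e => ?_, fun e => ?_, fun e => ?_, fun e => ?_, fun w => ?_⟩
    · exact (Lp.coeFn_add (f e) (f₂ e)).trans ((h3 e).add (k3 e))
    · exact (Lp.coeFn_add (h e) (k e)).trans ((h4 e).add (k4 e))
    · refine (Lp.coeFn_add (g e) (g₂ e)).trans (((h5 e).add (k5 e)).trans ?_)
      exact .of_forall fun x => by simp [add_comm]
    · simp [h6 e, k6 e]
    · have := congrArg₂ (· + ·) (h7 w) (k7 w)
      simp only [Pi.add_apply, neg_add, Finset.sum_add_distrib] at this ⊢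
      linear_combination this
  zero_mem' := by
    refine ⟨0, 0, 0, 0, 0, fun e => .zero _, fun e => .zero _, fun e => Lp.coeFn_zero _ _ _,
      fun e => Lp.coeFn_zero _ _ _, fun e => ?_, fun e => by simp, fun w => by simp⟩
    simpa using Lp.coeFn_zero ℂ 2 (volume.restrict (Icc (0 : ℝ) 1))
  smul_mem' := by
    rintro c ⟨f, g⟩ ⟨u, u', u'', F, h, h1, h2, h3, h4, h5, h6, h7⟩
    refine ⟨c • u, c • u', c • u'', c • F, c • h, fun e => (h1 e).smul c,
      fun e => (h2 e).smul c, fun e => ?_, fun e => ?_, fun e => ?_, fun e => ?_, fun w => ?_⟩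
    · exact (Lp.coeFn_smul c (f e)).trans ((h3 e).const_smul c)
    · exact (Lp.coeFn_smul c (h e)).trans ((h4 e).const_smul c)
    · refine (Lp.coeFn_smul c (g e)).trans (((h5 e).const_smul c).trans ?_)
      exact .of_forall fun x => by simp
    · simp [h6 e]
    · have := congrArg (c * ·) (h7 w)
      simpa [Finset.mul_sum, mul_add] using this

theorem kirchhoffGraph_singleValued {V E : Type} (src tgt : E → V)
    (hsrc : ∀ v, {e | src e = v}.Finite) (htgt : ∀ v, {e | tgt e = v}.Finite)
    (q : GraphL2 E × GraphL2 E) (hq : q ∈ kirchhoffGraph src tgt hsrc htgt)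
    (h0 : q.1 = 0) : q.2 = 0 := by
  obtain ⟨u, u', u'', F, h, h1, h2, h3, h4, h5, h6, h7⟩ := hq
  ext1
  funext e
  have hu : u e =ᵐ[volume.restrict (Icc 0 1)] 0 := by
    refine (h3 e).symm.trans ?_
    rw [h0]; exact Lp.coeFn_zero _ _ _
  have hu'' := (h2 e).deriv_ae_eq_zero (convex_Icc 0 1)
    ((h1 e).deriv_ae_eq_zero (convex_Icc 0 1) hu)
  refine (Lp.eq_zero_iff_ae_eq_zero).2 ?_
  filter_upwards [h5 e, hu''] with x h1 h2
  simp [h1, h2]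

/-- The Kirchhoff Laplacian `f ↦ -f''` in `L²(Γ)`. -/
noncomputable def kirchhoffLaplacian {V E : Type} (src tgt : E → V)
    (hsrc : ∀ v, {e | src e = v}.Finite) (htgt : ∀ v, {e | tgt e = v}.Finite) :
    GraphL2 E →ₗ.[ℂ] GraphL2 E :=
  (kirchhoffGraph src tgt hsrc htgt).toLinearPMap

/-! ### The two-sided sphere-layered graph -/

/-- The vertex set `⋃ₙ Sₙ` with `|Sₙ| = s n`. -/
abbrev LayeredVertex (s : ℤ → ℕ) : Type := Σ n : ℤ, Fin (s n)

/-- Two vertices are adjacent if and only if they lie in neighbouring spheres. -/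
def layeredGraph (s : ℤ → ℕ) : SimpleGraph (LayeredVertex s) where
  Adj u v := v.1 = u.1 - 1 ∨ v.1 = u.1 + 1
  symm := ⟨fun u v h => by omega⟩
  loopless := ⟨fun u h => by omega⟩

/-- The edges: `⟨n, i, j⟩` joins the `i`-th vertex of `Sₙ` to the `j`-th vertex of `Sₙ₊₁`. -/
abbrev LayeredEdge (s : ℤ → ℕ) : Type := Σ n : ℤ, Fin (s n) × Fin (s (n + 1))

namespace LayeredEdge

variable {s : ℤ → ℕ}

/-- The initial vertex of an edge. -/
def src (e : LayeredEdge s) : LayeredVertex s := ⟨e.1, e.2.1⟩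

/-- The terminal vertex of an edge. -/
def tgt (e : LayeredEdge s) : LayeredVertex s := ⟨e.1 + 1, e.2.2⟩

theorem adj (e : LayeredEdge s) : (layeredGraph s).Adj (src e) (tgt e) := Or.inr rfl

/-- Each edge of `layeredGraph s` is represented exactly once. -/
theorem bijective_edge : Function.Bijective fun e : LayeredEdge s =>
    (⟨s(src e, tgt e), adj e⟩ : (layeredGraph s).edgeSet) := by
  constructor
  · rintro ⟨n, i, j⟩ ⟨m, k, l⟩ h
    simp only [Subtype.mk.injEq, Sym2.eq_iff, src, tgt] at h
    rcases h with ⟨h1, h2⟩ | ⟨h1, h2⟩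
    · obtain rfl : n = m := congrArg Sigma.fst h1
      simp at h1 h2
      simp [h1, h2]
    · have e1 : n = m + 1 := congrArg Sigma.fst h1
      have e2 : n + 1 = m := congrArg Sigma.fst h2
      omega
  · rintro ⟨z, hz⟩
    induction z using Sym2.ind with
    | _ u v =>
      obtain ⟨n, i⟩ := u
      obtain ⟨m, j⟩ := v
      have h : m = n - 1 ∨ m = n + 1 := hz
      rcases h with h | h
      · obtain rfl : n = m + 1 := by omega
        exact ⟨⟨m, j, i⟩, Subtype.ext Sym2.eq_swap⟩
      · subst h
        exact ⟨⟨n, i, j⟩, rfl⟩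

theorem finite_src (v : LayeredVertex s) : {e : LayeredEdge s | src e = v}.Finite := by
  refine (Set.finite_range fun p : Fin (s v.1) × Fin (s (v.1 + 1)) =>
    (⟨v.1, p⟩ : LayeredEdge s)).subset ?_
  rintro e rfl
  exact ⟨e.2, rfl⟩

theorem finite_tgt (v : LayeredVertex s) : {e : LayeredEdge s | tgt e = v}.Finite := by
  refine (Set.finite_range fun p : Fin (s (v.1 - 1)) × Fin (s (v.1 - 1 + 1)) =>
    (⟨v.1 - 1, p⟩ : LayeredEdge s)).subset ?_
  rintro ⟨n, p⟩ h
  obtain rfl : n = v.1 - 1 := by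
    have : n + 1 = v.1 := congrArg Sigma.fst h
    omega
  exact ⟨p, rfl⟩

end LayeredEdge

/-- The Kirchhoff Laplacian `ℍ` of the layered graph with sphere numbers `s`. -/
noncomputable def layeredLaplacian (s : ℤ → ℕ) :
    GraphL2 (LayeredEdge s) →ₗ.[ℂ] GraphL2 (LayeredEdge s) :=
  kirchhoffLaplacian LayeredEdge.src LayeredEdge.tgt LayeredEdge.finite_src LayeredEdge.finite_tgt

/-! ### The one-dimensional operators -/

/-- The weight `μ = ∑ₙ sₙ sₙ₊₁ χ_[n, n+1)`. -/
noncomputable def layeredWeight (s : ℤ → ℕ) (x : ℝ) : ℝ := s ⌊x⌋ * s (⌊x⌋ + 1)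

theorem layeredWeight_eq (s : ℤ → ℕ) {n : ℤ} {x : ℝ} (hx : x ∈ Ico (n : ℝ) (n + 1)) :
    layeredWeight s x = s n * s (n + 1) := by
  rw [layeredWeight, Int.floor_eq_iff.2 hx]

theorem measurable_layeredWeight (s : ℤ → ℕ) : Measurable (layeredWeight s) :=
  (measurable_from_top (f := fun n : ℤ => (s n * s (n + 1) : ℝ))).comp Int.measurable_floor

theorem layeredWeight_pos {s : ℤ → ℕ} (hs : ∀ n, 0 < s n) (x : ℝ) : 0 < layeredWeight s x := by
  have h1 := hs ⌊x⌋
  have h2 := hs (⌊x⌋ + 1)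
  unfold layeredWeight
  positivity

/-- The full-line operator `H` in `L²(ℝ; μ)`. -/
noncomputable def lineOperator (s : ℤ → ℕ) :
    WeightedL2 (layeredWeight s) univ →ₗ.[ℂ] WeightedL2 (layeredWeight s) univ :=
  sturmLiouville (layeredWeight s) univ ∅

/-- The Dirichlet operator `Hₙ¹` on `(n - 1, n + 1)`; in `L²` the endpoints do not matter. -/
noncomputable def dirichletOne (s : ℤ → ℕ) (n : ℤ) :
    WeightedL2 (layeredWeight s) (Icc ((n : ℝ) - 1) (n + 1)) →ₗ.[ℂ]
      WeightedL2 (layeredWeight s) (Icc ((n : ℝ) - 1) (n + 1)) :=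
  sturmLiouville (layeredWeight s) (Icc ((n : ℝ) - 1) (n + 1)) {(n : ℝ) - 1, (n : ℝ) + 1}

/-- The Dirichlet operator `Hₙ²` on `(n, n + 1)`; in `L²` the endpoints do not matter. -/
noncomputable def dirichletTwo (s : ℤ → ℕ) (n : ℤ) :
    WeightedL2 (layeredWeight s) (Icc (n : ℝ) (n + 1)) →ₗ.[ℂ]
      WeightedL2 (layeredWeight s) (Icc (n : ℝ) (n + 1)) :=
  sturmLiouville (layeredWeight s) (Icc (n : ℝ) (n + 1)) {(n : ℝ), (n : ℝ) + 1}

/-- The index set of the direct sum: the line once, `sₙ - 1` copies of `Hₙ¹` and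
`(sₙ - 1)(sₙ₊₁ - 1)` copies of `Hₙ²` for each `n`. -/
inductive Piece (s : ℤ → ℕ) : Type
  | line : Piece s
  | one (n : ℤ) (j : Fin (s n - 1)) : Piece s
  | two (n : ℤ) (j : Fin ((s n - 1) * (s (n + 1) - 1))) : Piece s

/-- The interval on which a piece lives. -/
def Piece.interval {s : ℤ → ℕ} : Piece s → Set ℝ
  | .line => univ
  | .one n _ => Icc ((n : ℝ) - 1) (n + 1)
  | .two n _ => Icc (n : ℝ) (n + 1)

/-- The operator of a piece. -/
noncomputable def Piece.operator {s : ℤ → ℕ} : (i : Piece s) →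
    (WeightedL2 (layeredWeight s) i.interval →ₗ.[ℂ] WeightedL2 (layeredWeight s) i.interval)
  | .line => lineOperator s
  | .one n _ => dirichletOne s n
  | .two n _ => dirichletTwo s n

/-!
The functions on the `n`-th layer of the metric graph form `L²(0, 1) ⊗ ℂ^{Sₙ} ⊗ ℂ^{Sₙ₊₁}`. Split
each `ℂ^{Sₙ}` into the constants and their orthogonal complement, here by means of the Fourier basis
`fourierVector`, whose vector number `0` is the constant `1`. The four kinds of tensor products
of basis vectors give the four kinds of pieces on the layer: constant ⊗ constant belongs to the
line, nonconstant ⊗ constant to a copy of `Hₙ¹`, constant ⊗ nonconstant to a copy of `Hₙ₊₁¹`, and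
nonconstant ⊗ nonconstant to a copy of `Hₙ²` (`layerPiece`). Since the squared norm of such a tensor
product is `sₙ sₙ₊₁`, which is the weight on `[n, n + 1)`, every piece embeds isometrically into
`L²(Γ)`, and `L²(Γ)` is the Hilbert sum of the pieces (`isHilbertSum_pieceEmbed`).

To compare the operators everything is expressed on unit cells. On a single cell both operators
are the maximal operator `w ↦ -w''` on `H²(0, 1)`, and they differ only in the conditions on its
four boundary values `w(0), w(1), w'(0), w'(1)`, recorded in `unitTriples`. For the pieces the
conditions are continuity of `f` and of `μ f'` across the integers
(`mem_sturmLiouvilleGraph_iff`), for the metric graph they are the Kirchhoff conditions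
(`mem_layeredKirchhoffGraph_iff`). The two sets of conditions correspond to each other under the
Fourier transform at the vertices (`exists_isKirchhoff`, `isMatched_of_isKirchhoff`): a nonconstant
Fourier vector sums to zero over a sphere, which turns continuity at the next sphere into a Dirichlet
condition and makes the Kirchhoff condition there void.

The full-line operator is self-adjoint because all cells have length one. Green's identity with
cubic polynomials bounds the boundary values on a cell by the graph norm on that cell
(`exists_boundary_bound`), with the same constant for all cells. Hence the boundary terms of two
functions in the domain are summable over `ℤ`, and the telescoping sum of their differences
vanishes (`lineGraph_symmetric`). Conversely, a weak solution is regular on each cell and satisfies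
the matching conditions (`mem_lineGraph_of_weak`), so the adjoint has no larger domain.
-/

/-! ### Absolute continuity as an integral identity -/

/-- `v` is integrable between `a` and `b`, and the increment of `u` there is the integral of `v`. -/
def IncrementIsIntegral (u v : ℝ → ℂ) (a b : ℝ) : Prop :=
  IntervalIntegrable v volume a b ∧ u b - u a = ∫ x in a..b, v x

namespace IncrementIsIntegral

variable {u v : ℝ → ℂ} {a b c : ℝ}

theorem refl (u v : ℝ → ℂ) (a : ℝ) : IncrementIsIntegral u v a a := by
  simp [IncrementIsIntegral]

theorem symm (h : IncrementIsIntegral u v a b) : IncrementIsIntegral u v b a :=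
  ⟨h.1.symm, by rw [intervalIntegral.integral_symm, ← h.2]; ring⟩

theorem trans (h : IncrementIsIntegral u v a b) (h' : IncrementIsIntegral u v b c) :
    IncrementIsIntegral u v a c :=
  ⟨h.1.trans h'.1, by
    rw [← intervalIntegral.integral_add_adjacent_intervals h.1 h'.1, ← h.2, ← h'.2]; ring⟩

theorem congr_ae {v₂ : ℝ → ℂ} (h : IncrementIsIntegral u v a b)
    (hv : v =ᵐ[volume.restrict (uIoc a b)] v₂) : IncrementIsIntegral u v₂ a b :=
  ⟨h.1.congr_ae hv, by
    rw [h.2]; exact intervalIntegral.integral_congr_ae_restrict hv⟩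

theorem const_smul (k : ℂ) (h : IncrementIsIntegral u v a b) :
    IncrementIsIntegral (k • u) (k • v) a b :=
  ⟨h.1.smul k, by
    simp only [Pi.smul_apply, intervalIntegral.integral_smul, ← h.2, smul_sub]⟩

theorem comp_add_left (d : ℝ) (h : IncrementIsIntegral u v (d + a) (d + b)) :
    IncrementIsIntegral (fun t => u (d + t)) (fun t => v (d + t)) a b := by
  refine ⟨?_, ?_⟩
  · have := h.1.comp_add_left d
    simpa using this
  · rw [intervalIntegral.integral_comp_add_left]
    exact h.2

theorem comp_sub_right (d : ℝ) (h : IncrementIsIntegral u v a b) :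
    IncrementIsIntegral (fun x => u (x - d)) (fun x => v (x - d)) (d + a) (d + b) := by
  have : IncrementIsIntegral (fun x => u (-d + x)) (fun x => v (-d + x)) (d + a) (d + b) := by
    apply comp_add_left
    simpa using h
  simpa only [neg_add_eq_sub] using this

end IncrementIsIntegral

theorem AbsolutelyContinuousOnInterval.of_dist_le {X Y : Type*} [PseudoMetricSpace X]
    [PseudoMetricSpace Y] {f : ℝ → X} {g : ℝ → Y} {a b : ℝ}
    (hf : AbsolutelyContinuousOnInterval f a b) (h : ∀ x y, dist (g x) (g y) ≤ dist (f x) (f y)) :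
    AbsolutelyContinuousOnInterval g a b := by
  rw [absolutelyContinuousOnInterval_iff] at hf ⊢
  intro ε hε
  obtain ⟨δ, hδ, hE⟩ := hf ε hε
  exact ⟨δ, hδ, fun E h1 h2 => (Finset.sum_le_sum fun i _ => h _ _).trans_lt (hE E h1 h2)⟩

theorem AbsolutelyContinuousOnInterval.re {u : ℝ → ℂ} {a b : ℝ}
    (h : AbsolutelyContinuousOnInterval u a b) :
    AbsolutelyContinuousOnInterval (fun x => (u x).re) a b :=
  h.of_dist_le fun x y => by
    simpa [dist_eq_norm] using Complex.abs_re_le_norm (u x - u y)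

theorem AbsolutelyContinuousOnInterval.im {u : ℝ → ℂ} {a b : ℝ}
    (h : AbsolutelyContinuousOnInterval u a b) :
    AbsolutelyContinuousOnInterval (fun x => (u x).im) a b :=
  h.of_dist_le fun x y => by
    simpa [dist_eq_norm] using Complex.abs_im_le_norm (u x - u y)

theorem AbsolutelyContinuousOnInterval.ofReal {f : ℝ → ℝ} {a b : ℝ}
    (h : AbsolutelyContinuousOnInterval f a b) :
    AbsolutelyContinuousOnInterval (fun x => (f x : ℂ)) a b :=
  h.of_dist_le fun x y => by simp [dist_eq_norm, ← Complex.ofReal_sub]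

theorem IsACWithDeriv.incrementIsIntegral {I : Set ℝ} (hI : I.OrdConnected) {u v : ℝ → ℂ}
    (h : IsACWithDeriv I u v) {a b : ℝ} (ha : a ∈ I) (hb : b ∈ I) :
    IncrementIsIntegral u v a b := by
  have hac := h.ac a ha b hb
  have hsub : uIoc a b ⊆ I := uIoc_subset_uIcc.trans (hI.uIcc_subset ha hb)
  have hd : ∀ᵐ x ∂(volume.restrict (uIoc a b)), HasDerivAt u (v x) x :=
    ae_restrict_of_ae_restrict_of_subset hsub h.hasDeriv
  have hre : (fun x => deriv (fun y => (u y).re) x) =ᵐ[volume.restrict (uIoc a b)]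
      fun x => (v x).re := by
    filter_upwards [hd] with x hx
    exact (Complex.reCLM.hasFDerivAt.comp_hasDerivAt x hx).deriv
  have him : (fun x => deriv (fun y => (u y).im) x) =ᵐ[volume.restrict (uIoc a b)]
      fun x => (v x).im := by
    filter_upwards [hd] with x hx
    exact (Complex.imCLM.hasFDerivAt.comp_hasDerivAt x hx).deriv
  have ire := hac.re.intervalIntegrable_deriv.congr_ae hre
  have iim := hac.im.intervalIntegrable_deriv.congr_ae him
  have key : ∀ x, v x = ((v x).re : ℂ) + ((v x).im : ℂ) * Complex.I := fun x =>
    (Complex.re_add_im _).symm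
  have c1 : IntervalIntegrable (fun x => ((v x).re : ℂ)) volume a b :=
    ⟨ire.1.ofReal, ire.2.ofReal⟩
  have c2 : IntervalIntegrable (fun x => ((v x).im : ℂ) * Complex.I) volume a b :=
    IntervalIntegrable.mul_const ⟨iim.1.ofReal, iim.2.ofReal⟩ _
  refine ⟨?_, ?_⟩
  · exact (c1.add c2).congr fun x _ => (key x).symm
  · rw [intervalIntegral.integral_congr (fun x _ => key x), intervalIntegral.integral_add c1 c2,
      intervalIntegral.integral_mul_const, intervalIntegral.integral_ofReal,
      intervalIntegral.integral_ofReal, ← intervalIntegral.integral_congr_ae_restrict hre,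
      ← intervalIntegral.integral_congr_ae_restrict him, hac.re.integral_deriv_eq_sub,
      hac.im.integral_deriv_eq_sub]
    apply Complex.ext <;> simp

theorem IsACWithDeriv.of_incrementIsIntegral_Icc {u v : ℝ → ℂ} {a b : ℝ} (hab : a ≤ b)
    (h : ∀ x ∈ Icc a b, IncrementIsIntegral u v a x) : IsACWithDeriv (Icc a b) u v := by
  have hb := h b (right_mem_Icc.2 hab)
  have hu : ∀ x ∈ Icc a b, u x = u a + ∫ t in a..x, v t := fun x hx => by
    rw [← (h x hx).2]; ring
  have hac : AbsolutelyContinuousOnInterval u a b := by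
    have h1 := (IntervalIntegrable.absolutelyContinuousOnInterval_intervalIntegral
      (f := fun x => (v x).re) (a := a) (b := b) (c := a)
      ⟨hb.1.1.re, hb.1.2.re⟩ (by simp)).ofReal
    have h2 := (IntervalIntegrable.absolutelyContinuousOnInterval_intervalIntegral
      (f := fun x => (v x).im) (a := a) (b := b) (c := a)
      ⟨hb.1.1.im, hb.1.2.im⟩ (by simp)).ofReal
    have h3 := h1.add (h2.const_smul Complex.I)
    rw [absolutelyContinuousOnInterval_iff] at h3 ⊢
    intro ε hε
    obtain ⟨δ, hδ, hE⟩ := h3 ε hε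
    refine ⟨δ, hδ, fun E e1 e2 => (hE E e1 e2).trans_eq' (Finset.sum_congr rfl fun i hi => ?_)⟩
    have hm := e1.1 i hi
    rw [uIcc_of_le hab] at hm
    have hx : ∀ x ∈ Icc a b, u x = u a + (((∫ t in a..x, (v t).re : ℝ) : ℂ) +
        Complex.I • ((∫ t in a..x, (v t).im : ℝ) : ℂ)) := by
      intro x hx
      have hi := (h x hx).1
      rw [hu x hx]
      congr 1
      rw [intervalIntegral.integral_of_le hx.1, intervalIntegral.integral_of_le hx.1,
        intervalIntegral.integral_of_le hx.1, smul_eq_mul, mul_comm]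
      exact (integral_re_add_im (𝕜 := ℂ) hi.1).symm
    rw [hx _ hm.1, hx _ hm.2, dist_add_left]
    rfl
  refine ⟨fun x hx y hy => hac.mono ?_, ?_⟩
  · rw [uIcc_of_le hab]; exact ordConnected_Icc.uIcc_subset hx hy
  · have h1 : ∀ᵐ x ∂(volume.restrict (Icc a b)), x ∈ Ioo a b := by
      rw [restrict_Ioo_eq_restrict_Icc.symm]
      exact ae_restrict_mem measurableSet_Ioo
    filter_upwards [h1, ae_restrict_of_ae hb.1.ae_hasDerivAt_integral] with x hx hd
    have hd' := (hd (by rw [uIcc_of_le hab]; exact Ioo_subset_Icc_self hx) a (by simp)).const_add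
      (u a)
    refine hd'.congr_of_eventuallyEq ?_
    filter_upwards [Icc_mem_nhds hx.1 hx.2] with y hy using hu y hy

theorem IsACWithDeriv.mono {I J : Set ℝ} {u v : ℝ → ℂ} (h : IsACWithDeriv I u v) (hJ : J ⊆ I) :
    IsACWithDeriv J u v :=
  ⟨fun a ha b hb => h.ac a (hJ ha) b (hJ hb),
    ae_restrict_of_ae_restrict_of_subset hJ h.hasDeriv⟩

theorem IsACWithDeriv.of_incrementIsIntegral_univ {u v : ℝ → ℂ}
    (h : ∀ x, IncrementIsIntegral u v 0 x) : IsACWithDeriv univ u v := by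
  have hab : ∀ a b : ℝ, a ≤ b → IsACWithDeriv (Icc a b) u v := fun a b hab =>
    .of_incrementIsIntegral_Icc hab fun x _ => (h a).symm.trans (h x)
  refine ⟨fun a _ b _ => ?_, ?_⟩
  · have h1 := hab (min a b) (max a b) min_le_max
    exact h1.ac a ⟨min_le_left _ _, le_max_left _ _⟩ b ⟨min_le_right _ _, le_max_right _ _⟩
  · have : (univ : Set ℝ) = ⋃ n : ℕ, Icc (-(n : ℝ)) n := by
      refine (eq_univ_of_forall fun x => ?_).symm
      obtain ⟨n, hn⟩ := exists_nat_ge |x|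
      exact mem_iUnion.2 ⟨n, abs_le.1 hn⟩
    rw [this, ae_restrict_iUnion_iff]
    intro n
    have : (0 : ℝ) ≤ n := n.cast_nonneg
    exact (hab _ _ (by linarith)).hasDeriv

namespace IsACWithDeriv

variable {I : Set ℝ} {u u' v v' : ℝ → ℂ}

theorem mul (hu : IsACWithDeriv I u u') (hv : IsACWithDeriv I v v') :
    IsACWithDeriv I (u * v) (u' * v + u * v') where
  ac a ha b hb := (hu.ac a ha b hb).smul (hv.ac a ha b hb)
  hasDeriv := by
    filter_upwards [hu.hasDeriv, hv.hasDeriv] with x h1 h2 using h1.mul h2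

theorem star (hu : IsACWithDeriv I u u') : IsACWithDeriv I (star u) (star u') where
  ac a ha b hb := (hu.ac a ha b hb).of_dist_le fun x y => by
    simp [dist_eq_norm, ← map_sub]
  hasDeriv := by
    filter_upwards [hu.hasDeriv] with x h1 using h1.star

theorem continuousOn_Icc {a b : ℝ} (hab : a ≤ b) (hu : IsACWithDeriv (Icc a b) u u') :
    ContinuousOn u (Icc a b) := by
  have := (hu.ac a (left_mem_Icc.2 hab) b (right_mem_Icc.2 hab)).continuousOn
  rwa [uIcc_of_le hab] at this

theorem of_hasDerivAt {a b : ℝ} (hab : a ≤ b) (h : ∀ x, HasDerivAt u (u' x) x)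
    (hc : Continuous u') : IsACWithDeriv (Icc a b) u u' := by
  refine .of_incrementIsIntegral_Icc hab fun x _ => ⟨hc.intervalIntegrable _ _, ?_⟩
  exact (intervalIntegral.integral_eq_sub_of_hasDerivAt (fun y _ => h y)
    (hc.intervalIntegrable _ _)).symm

end IsACWithDeriv

/-! ### Second order operators on the unit interval -/

/-- The Hilbert space `L²(0, 1)`. -/
abbrev UnitL2 : Type := Lp ℂ 2 (volume.restrict (Icc (0 : ℝ) 1))

/-- The maximal operator `w ↦ -w''` on `H²(0, 1)` together with its boundary values: triples
`(w, -w'', (w(0), w(1), w'(0), w'(1)))`. -/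
def unitTriples : Submodule ℂ (UnitL2 × UnitL2 × (Fin 4 → ℂ)) where
  carrier := {q | ∃ w r v : ℝ → ℂ, IsACWithDeriv (Icc 0 1) w r ∧ IsACWithDeriv (Icc 0 1) r v ∧
    q.1 =ᵐ[volume.restrict (Icc 0 1)] w ∧ q.2.1 =ᵐ[volume.restrict (Icc 0 1)] -v ∧
    q.2.2 = ![w 0, w 1, r 0, r 1]}
  add_mem' := by
    rintro ⟨x, y, γ⟩ ⟨x₂, y₂, γ₂⟩ ⟨w, r, v, h1, h2, h3, h4, h5⟩ ⟨w₂, r₂, v₂, k1, k2, k3, k4, k5⟩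
    refine ⟨w + w₂, r + r₂, v + v₂, h1.add k1, h2.add k2, (Lp.coeFn_add _ _).trans (h3.add k3),
      ((Lp.coeFn_add _ _).trans (h4.add k4)).trans (.of_forall fun x => ?_), ?_⟩
    · simp [add_comm]
    · simp only [Prod.mk_add_mk] at h5 k5 ⊢
      rw [h5, k5]; simp
  zero_mem' := by
    refine ⟨0, 0, 0, .zero _, .zero _, Lp.coeFn_zero _ _ _, ?_, ?_⟩
    · simpa using Lp.coeFn_zero ℂ 2 (volume.restrict (Icc (0 : ℝ) 1))
    · ext i; fin_cases i <;> rfl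
  smul_mem' := by
    rintro c ⟨x, y, γ⟩ ⟨w, r, v, h1, h2, h3, h4, h5⟩
    refine ⟨c • w, c • r, c • v, h1.smul c, h2.smul c,
      (Lp.coeFn_smul _ _).trans (h3.const_smul c),
      ((Lp.coeFn_smul _ _).trans (h4.const_smul c)).trans (.of_forall fun x => ?_), ?_⟩
    · simp
    · simp only [Prod.smul_mk] at h5 ⊢
      rw [h5]; simp

theorem IsACWithDeriv.memLp {w r : ℝ → ℂ} (h : IsACWithDeriv (Icc 0 1) w r) :
    MemLp w 2 (volume.restrict (Icc (0 : ℝ) 1)) := by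
  have hc := h.continuousOn_Icc zero_le_one
  obtain ⟨C, hC⟩ := isCompact_Icc.exists_bound_of_continuousOn hc
  exact MemLp.of_bound (hc.aestronglyMeasurable measurableSet_Icc) C
    ((ae_restrict_iff' measurableSet_Icc).2 (.of_forall hC))

/-- Green's identity: both sides are the integral of the derivative of `w̄ w₂' - w̄' w₂`. -/
theorem unitTriples_green {x y x₂ y₂ : UnitL2} {γ γ₂ : Fin 4 → ℂ} (h : (x, y, γ) ∈ unitTriples)
    (h₂ : (x₂, y₂, γ₂) ∈ unitTriples) :
    inner ℂ y x₂ - inner ℂ x y₂ =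
      (star (γ 1) * γ₂ 3 - star (γ 3) * γ₂ 1) - (star (γ 0) * γ₂ 2 - star (γ 2) * γ₂ 0) := by
  obtain ⟨w, r, v, h1, h2, h3, h4, h5⟩ := h
  obtain ⟨w₂, r₂, v₂, k1, k2, k3, k4, k5⟩ := h₂
  simp only at h3 h4 h5 k3 k4 k5
  have hφ := (h1.star.mul k2).add ((h2.star.mul k1).smul (-1))
  have hi := (hφ.incrementIsIntegral ordConnected_Icc (left_mem_Icc.2 zero_le_one)
    (right_mem_Icc.2 zero_le_one)).2
  rw [L2.inner_def, L2.inner_def, ← integral_sub (L2.integrable_inner _ _)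
    (L2.integrable_inner _ _)]
  rw [h5, k5]
  rw [intervalIntegral.integral_of_le zero_le_one, ← integral_Icc_eq_integral_Ioc] at hi
  have : ∫ t in Icc (0 : ℝ) 1, (inner ℂ (y t) (x₂ t) - inner ℂ (x t) (y₂ t)) =
      ∫ t in Icc (0 : ℝ) 1,
        (star r * r₂ + star w * v₂ + (-1 : ℂ) • (star v * w₂ + star r * r₂)) t := by
    refine integral_congr_ae ?_
    filter_upwards [h3, h4, k3, k4] with t a1 a2 a3 a4
    simp [a1, a2, a3, a4]
    ring
  rw [this, ← hi]
  simp
  ring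

/-- The Dirichlet problem with initial data: `-w'' = y`, `w(0) = w'(0) = 0` is solvable. -/
theorem exists_unitTriples_of_source (y : UnitL2) :
    ∃ (x : UnitL2) (b b' : ℂ), (x, y, ![0, b, 0, b']) ∈ unitTriples := by
  have hy : IntervalIntegrable (fun t => -y t) volume 0 1 := by
    rw [intervalIntegrable_iff_integrableOn_Icc_of_le zero_le_one]
    exact ((Lp.memLp y).integrable one_le_two).neg
  set r : ℝ → ℂ := fun t => ∫ s in (0 : ℝ)..t, -y s with hr
  have hr1 : IsACWithDeriv (Icc 0 1) r (fun t => -y t) := by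
    refine .of_incrementIsIntegral_Icc zero_le_one fun t ht => ⟨?_, by simp [r]⟩
    refine hy.mono_set ?_
    rw [uIcc_of_le ht.1, uIcc_of_le zero_le_one]
    exact Icc_subset_Icc_right ht.2
  have hc := hr1.continuousOn_Icc zero_le_one
  set w : ℝ → ℂ := fun t => ∫ s in (0 : ℝ)..t, r s with hw
  have hw1 : IsACWithDeriv (Icc 0 1) w r := by
    refine .of_incrementIsIntegral_Icc zero_le_one fun t ht => ⟨?_, by simp [w]⟩
    refine (hc.mono ?_).intervalIntegrable
    rw [uIcc_of_le ht.1]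
    exact Icc_subset_Icc_right ht.2
  refine ⟨hw1.memLp.toLp w, w 1, r 1, w, r, fun t => -y t, hw1, hr1, hw1.memLp.coeFn_toLp, ?_, ?_⟩
  · exact .of_forall fun t => by simp
  · simp [w, r]

/-- Every quadruple of boundary values is attained by a cubic polynomial. -/
theorem exists_unitTriples_of_boundary (γ : Fin 4 → ℂ) :
    ∃ x y : UnitL2, (x, y, γ) ∈ unitTriples := by
  -- Hermite interpolation: `w(t) = γ₀ + γ₂ t + c₂ t² + c₃ t³`.
  set c₂ : ℂ := 3 * (γ 1 - γ 0) - 2 * γ 2 - γ 3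
  set c₃ : ℂ := 2 * (γ 0 - γ 1) + γ 2 + γ 3
  set w : ℝ → ℂ := fun t => γ 0 + γ 2 * t + c₂ * t ^ 2 + c₃ * t ^ 3
  set r : ℝ → ℂ := fun t => γ 2 + 2 * c₂ * t + 3 * c₃ * t ^ 2
  set v : ℝ → ℂ := fun t => 2 * c₂ + 6 * c₃ * t
  have hid (t : ℝ) : HasDerivAt (fun t : ℝ => (t : ℂ)) 1 t := Complex.ofRealCLM.hasDerivAt
  have hw : IsACWithDeriv (Icc 0 1) w r := by
    refine .of_hasDerivAt zero_le_one (fun t => ?_) (by fun_prop)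
    refine (((((hid t).const_mul (γ 2)).const_add (γ 0)).add (((hid t).pow 2).const_mul c₂)).add
      (((hid t).pow 3).const_mul c₃)).congr_deriv ?_
    simp only [r]; push_cast; ring
  have hr : IsACWithDeriv (Icc 0 1) r v := by
    refine .of_hasDerivAt zero_le_one (fun t => ?_) (by fun_prop)
    refine ((((hid t).const_mul (2 * c₂)).const_add (γ 2)).add
      (((hid t).pow 2).const_mul (3 * c₃))).congr_deriv ?_
    simp only [v]; push_cast; ring
  have hv : IsACWithDeriv (Icc 0 1) v (fun _ => 6 * c₃) := by
    refine .of_hasDerivAt zero_le_one (fun t => ?_) (by fun_prop)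
    exact (((hid t).const_mul (6 * c₃)).const_add (2 * c₂)).congr_deriv (mul_one _)
  refine ⟨hw.memLp.toLp w, hv.memLp.neg.toLp (-v), w, r, v, hw, hr, hw.memLp.coeFn_toLp,
    hv.memLp.neg.coeFn_toLp, ?_⟩
  ext i
  fin_cases i
  · simp [w, r, c₂, c₃]
  · simp [w, r, c₂, c₃]; ring
  · simp [w, r, c₂, c₃]
  · simp [w, r, c₂, c₃]; ring

/-- Each boundary value is bounded by the graph norm: by Green's identity it is the pairing with
a fixed cubic polynomial. -/
theorem exists_boundary_bound : ∃ C : ℝ, 0 ≤ C ∧ ∀ (x y : UnitL2) (γ : Fin 4 → ℂ),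
    (x, y, γ) ∈ unitTriples → ∀ i, ‖γ i‖ ≤ C * (‖x‖ + ‖y‖) := by
  have key : ∀ δ : Fin 4 → ℂ, ∃ C : ℝ, 0 ≤ C ∧ ∀ (x y : UnitL2) (γ : Fin 4 → ℂ),
      (x, y, γ) ∈ unitTriples →
      ‖(star (γ 1) * δ 3 - star (γ 3) * δ 1) - (star (γ 0) * δ 2 - star (γ 2) * δ 0)‖ ≤
        C * (‖x‖ + ‖y‖) := by
    intro δ
    obtain ⟨x₂, y₂, h₂⟩ := exists_unitTriples_of_boundary δ
    refine ⟨‖x₂‖ + ‖y₂‖, by positivity, fun x y γ h => ?_⟩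
    rw [← unitTriples_green h h₂]
    have e1 := norm_inner_le_norm (𝕜 := ℂ) y x₂
    have e2 := norm_inner_le_norm (𝕜 := ℂ) x y₂
    have e3 := norm_sub_le (inner ℂ y x₂) (inner ℂ x y₂)
    nlinarith [norm_nonneg x, norm_nonneg y, norm_nonneg x₂, norm_nonneg y₂,
      mul_nonneg (norm_nonneg x) (norm_nonneg x₂), mul_nonneg (norm_nonneg y) (norm_nonneg y₂)]
  -- These four choices of `δ` isolate `γ 0`, `γ 1`, `γ 2` and `γ 3` in the boundary form.
  obtain ⟨C0, p0, h0⟩ := key ![0, 0, 1, 0]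
  obtain ⟨C1, p1, h1⟩ := key ![0, 0, 0, 1]
  obtain ⟨C2, p2, h2⟩ := key ![1, 0, 0, 0]
  obtain ⟨C3, p3, h3⟩ := key ![0, 1, 0, 0]
  refine ⟨C0 + C1 + C2 + C3, by positivity, fun x y γ h i => ?_⟩
  have a0 := h0 x y γ h
  have a1 := h1 x y γ h
  have a2 := h2 x y γ h
  have a3 := h3 x y γ h
  simp at a0 a1 a2 a3
  have hn : 0 ≤ ‖x‖ + ‖y‖ := by positivity
  have b0 := mul_nonneg p0 hn
  have b1 := mul_nonneg p1 hn
  have b2 := mul_nonneg p2 hn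
  have b3 := mul_nonneg p3 hn
  fin_cases i <;> simp <;> nlinarith

/-- The interpolation estimate `‖w'‖ ≤ C (‖w‖ + ‖w''‖)` on the unit interval. -/
theorem exists_deriv_bound : ∃ C : ℝ, 0 ≤ C ∧ ∀ (x y : UnitL2) (w r v : ℝ → ℂ),
    IsACWithDeriv (Icc 0 1) w r → IsACWithDeriv (Icc 0 1) r v →
    x =ᵐ[volume.restrict (Icc 0 1)] w → y =ᵐ[volume.restrict (Icc 0 1)] -v →
    ∃ h : UnitL2, h =ᵐ[volume.restrict (Icc 0 1)] r ∧ ‖h‖ ≤ C * (‖x‖ + ‖y‖) := by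
  obtain ⟨C, hC, hb⟩ := exists_boundary_bound
  refine ⟨C + 1, by positivity, fun x y w r v hw hr hx hy => ?_⟩
  have h0 : ‖r 0‖ ≤ C * (‖x‖ + ‖y‖) := hb x y _ ⟨w, r, v, hw, hr, hx, hy, rfl⟩ 2
  have hprob : IsProbabilityMeasure (volume.restrict (Icc (0 : ℝ) 1)) :=
    ⟨by simp⟩
  have hL1 : ∫ t in Icc (0 : ℝ) 1, ‖v t‖ ≤ ‖y‖ := by
    have e1 : ∫ t in Icc (0 : ℝ) 1, ‖v t‖ = ∫ t in Icc (0 : ℝ) 1, ‖y t‖ := by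
      refine integral_congr_ae ?_
      filter_upwards [hy] with t ht
      simp [ht]
    rw [e1, integral_norm_eq_lintegral_enorm (Lp.aestronglyMeasurable y), Lp.norm_def]
    refine ENNReal.toReal_mono (Lp.eLpNorm_ne_top y) ?_
    rw [← eLpNorm_one_eq_lintegral_enorm]
    exact eLpNorm_le_eLpNorm_of_exponent_le one_le_two (Lp.aestronglyMeasurable y)
  have hrb : ∀ t ∈ Icc (0 : ℝ) 1, ‖r t‖ ≤ (C + 1) * (‖x‖ + ‖y‖) := by
    intro t ht
    have hi := hr.incrementIsIntegral ordConnected_Icc (left_mem_Icc.2 zero_le_one) ht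
    have h1 := (hr.incrementIsIntegral ordConnected_Icc (left_mem_Icc.2 zero_le_one)
      (right_mem_Icc.2 zero_le_one)).1
    rw [intervalIntegrable_iff_integrableOn_Icc_of_le zero_le_one] at h1
    have e1 : ‖∫ s in (0 : ℝ)..t, v s‖ ≤ ∫ s in Icc (0 : ℝ) 1, ‖v s‖ := by
      refine (intervalIntegral.norm_integral_le_integral_norm ht.1).trans ?_
      rw [intervalIntegral.integral_of_le ht.1]
      refine setIntegral_mono_set h1.norm (.of_forall fun _ => norm_nonneg _)
        (Filter.Eventually.of_forall fun s hs => ⟨hs.1.le, hs.2.trans ht.2⟩)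
    have e2 : r t = r 0 + ∫ s in (0 : ℝ)..t, v s := by rw [← hi.2]; ring
    rw [e2]
    refine (norm_add_le _ _).trans ?_
    nlinarith [norm_nonneg x]
  refine ⟨hr.memLp.toLp r, hr.memLp.coeFn_toLp, ?_⟩
  have := Lp.norm_le_of_ae_bound (f := hr.memLp.toLp r) (C := (C + 1) * (‖x‖ + ‖y‖))
    (by positivity) (by
      filter_upwards [hr.memLp.coeFn_toLp, ae_restrict_mem measurableSet_Icc] with t h1 h2
      rw [h1]; exact hrb t h2)
  have hm : measureUnivNNReal (volume.restrict (Icc (0 : ℝ) 1)) = 1 := by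
    simp [measureUnivNNReal]
  simpa [hm] using this

/-- Regularity of weak solutions: the adjoint of the minimal operator is the maximal operator.
The range of the minimal operator is the orthogonal complement of the affine functions. -/
theorem exists_unitTriples_of_weak {g h : UnitL2}
    (H : ∀ x y : UnitL2, (x, y, 0) ∈ unitTriples → inner ℂ y g = inner ℂ x h) :
    ∃ γ, (g, h, γ) ∈ unitTriples := by
  obtain ⟨w, b, b', hw⟩ := exists_unitTriples_of_source h
  have haff : ∃ e₀ e₁ : UnitL2, (e₀, 0, ![1, 1, 0, 0]) ∈ unitTriples ∧
      (e₁, 0, ![0, 1, 1, 1]) ∈ unitTriples := by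
    have h1 : IsACWithDeriv (Icc 0 1) (fun _ => (1 : ℂ)) 0 :=
      .of_hasDerivAt zero_le_one (fun t => hasDerivAt_const t 1) continuous_const
    have hz : ((0 : UnitL2) : ℝ → ℂ) =ᵐ[volume.restrict (Icc (0 : ℝ) 1)] -0 := by
      simpa using Lp.coeFn_zero ℂ 2 (volume.restrict (Icc (0 : ℝ) 1))
    have h2 : IsACWithDeriv (Icc 0 1) (fun t : ℝ => (t : ℂ)) (fun _ => 1) :=
      .of_hasDerivAt zero_le_one (fun t => Complex.ofRealCLM.hasDerivAt) continuous_const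
    exact ⟨h1.memLp.toLp _, h2.memLp.toLp _, ⟨_, _, _, h1, .zero _, h1.memLp.coeFn_toLp, hz, rfl⟩,
      ⟨_, _, _, h2, h1, h2.memLp.coeFn_toLp, hz, by simp⟩⟩
  obtain ⟨e₀, e₁, h₀, h₁⟩ := haff
  -- `w` solves `-w'' = h`; it remains to see that `g - w` is affine. A function `y` orthogonal to
  -- the affine functions is `-x''` for some `x` with vanishing boundary values.
  have hmem : g - w ∈ (Submodule.span ℂ {e₀, e₁})ᗮᗮ := by
    rw [Submodule.mem_orthogonal]
    intro y hy
    rw [Submodule.mem_orthogonal'] at hy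
    obtain ⟨x, c, c', hx⟩ := exists_unitTriples_of_source y
    have g0 := unitTriples_green hx h₀
    have g1 := unitTriples_green hx h₁
    rw [hy e₀ (Submodule.subset_span (by simp))] at g0
    rw [hy e₁ (Submodule.subset_span (by simp))] at g1
    simp at g0
    simp [g0, eq_comm (a := (0 : ℂ))] at g1
    have hx0 : (x, y, (0 : Fin 4 → ℂ)) ∈ unitTriples := by
      convert hx using 3
      ext i
      fin_cases i <;> simp [g0, g1]
    have gw := unitTriples_green hx0 hw
    simp at gw
    rw [inner_sub_right, H x y hx0]
    linear_combination -gw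
  have := FiniteDimensional.span_of_finite ℂ (toFinite {e₀, e₁})
  rw [Submodule.orthogonal_orthogonal, Submodule.mem_span_pair] at hmem
  obtain ⟨p, q, hpq⟩ := hmem
  have := unitTriples.add_mem (unitTriples.add_mem (unitTriples.smul_mem p h₀)
    (unitTriples.smul_mem q h₁)) hw
  have e : p • e₀ + q • e₁ + w = g := by rw [hpq]; abel
  simp only [Prod.smul_mk, Prod.mk_add_mk, smul_zero, zero_add, e] at this
  exact ⟨_, this⟩

/-! ### Decomposition of the weighted spaces into unit cells -/

/-- The constant value `sₘ sₘ₊₁` of the weight on the cell `[m, m + 1)`. -/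
noncomputable def cellWeight (s : ℤ → ℕ) (m : ℤ) : ℝ := s m * s (m + 1)

theorem cellWeight_pos {s : ℤ → ℕ} (hs : ∀ n, 0 < s n) (m : ℤ) : 0 < cellWeight s m := by
  have h1 := hs m
  have h2 := hs (m + 1)
  unfold cellWeight
  positivity

theorem measurePreserving_cell (m : ℤ) :
    MeasurePreserving (fun t : ℝ => (m : ℝ) + t) (volume.restrict (Icc 0 1))
      (volume.restrict (Ico (m : ℝ) (m + 1))) := by
  have h := (measurePreserving_add_left volume (m : ℝ)).restrict_preimage
    (s := Icc (m : ℝ) (m + 1)) measurableSet_Icc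
  rw [restrict_Ico_eq_restrict_Icc]
  simpa using h

theorem measurableEmbedding_cell (m : ℤ) : MeasurableEmbedding fun t : ℝ => (m : ℝ) + t :=
  measurableEmbedding_addLeft _

theorem ae_iff_forall_cell {P : ℝ → Prop} :
    (∀ᵐ x, P x) ↔ ∀ m : ℤ, ∀ᵐ t ∂(volume.restrict (Icc (0 : ℝ) 1)), P (m + t) := by
  have h : (∀ᵐ x, P x) ↔ ∀ᵐ x ∂(volume.restrict (⋃ n : ℤ, Ico (n : ℝ) (n + 1))), P x := by
    rw [iUnion_Ico_intCast, Measure.restrict_univ]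
  rw [h, ae_restrict_iUnion_iff]
  refine forall_congr' fun m => ?_
  rw [← (measurePreserving_cell m).map_eq, (measurableEmbedding_cell m).ae_map_iff]

section

variable {s : ℤ → ℕ}

theorem ae_weightedMeasure_iff (hs : ∀ n, 0 < s n) {I : Set ℝ} (hI : MeasurableSet I)
    {P : ℝ → Prop} : (∀ᵐ x ∂(weightedMeasure (layeredWeight s) I), P x) ↔
      ∀ m : ℤ, ∀ᵐ t ∂(volume.restrict (Icc (0 : ℝ) 1)), (m + t : ℝ) ∈ I → P (m + t) := by
  rw [weightedMeasure, ae_withDensity_iff (measurable_layeredWeight s).ennreal_ofReal,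
    ae_restrict_iff' hI, ae_iff_forall_cell]
  simp [layeredWeight_pos hs]

theorem ae_restrict_iff_forall_cell {I : Set ℝ} (hI : MeasurableSet I) {P : ℝ → Prop} :
    (∀ᵐ x ∂(volume.restrict I), P x) ↔
      ∀ m : ℤ, ∀ᵐ t ∂(volume.restrict (Icc (0 : ℝ) 1)), (m + t : ℝ) ∈ I → P (m + t) := by
  rw [ae_restrict_iff' hI, ae_iff_forall_cell]

theorem layeredWeight_cell_ae (s : ℤ → ℕ) (m : ℤ) :
    ∀ᵐ t ∂(volume.restrict (Icc (0 : ℝ) 1)), layeredWeight s (m + t) = cellWeight s m := by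
  rw [← restrict_Ico_eq_restrict_Icc]
  filter_upwards [ae_restrict_mem measurableSet_Ico] with t ht
  exact layeredWeight_eq s ⟨by linarith [ht.1], by linarith [ht.2]⟩

theorem hasSum_integral_cells (hs : ∀ n, 0 < s n) {I : Set ℝ} (hI : MeasurableSet I)
    {E : Type*} [NormedAddCommGroup E] [NormedSpace ℝ E] {F : ℝ → E}
    (hF : Integrable F (weightedMeasure (layeredWeight s) I)) :
    (∀ m : ℤ, Integrable (fun t : ℝ => I.indicator F (m + t)) (volume.restrict (Icc 0 1))) ∧
    HasSum (fun m : ℤ => cellWeight s m • ∫ t in Icc (0 : ℝ) 1, I.indicator F (m + t))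
      (∫ x, F x ∂(weightedMeasure (layeredWeight s) I)) := by
  have hm : Measurable fun x => ENNReal.ofReal (layeredWeight s x) :=
    (measurable_layeredWeight s).ennreal_ofReal
  have hfin : ∀ᵐ x ∂(volume.restrict I), ENNReal.ofReal (layeredWeight s x) < ⊤ :=
    .of_forall fun x => ENNReal.ofReal_lt_top
  have hF' := (integrable_withDensity_iff_integrable_smul' hm hfin).1 hF
  rw [weightedMeasure, integral_withDensity_eq_integral_toReal_smul hm hfin]
  simp only [ENNReal.toReal_ofReal (layeredWeight_pos hs _).le] at hF' ⊢
  set G : ℝ → E := fun x => layeredWeight s x • I.indicator F x with hG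
  have e : G = I.indicator fun x => layeredWeight s x • F x := by
    ext x
    by_cases h : x ∈ I <;> simp [hG, h]
  have hGi : Integrable G := by
    rw [e]; exact (integrable_indicator_iff hI).2 hF'
  have hcell : ∀ m : ℤ, (fun t : ℝ => G (m + t)) =ᵐ[volume.restrict (Icc 0 1)]
      fun t => cellWeight s m • I.indicator F (m + t) := by
    intro m
    filter_upwards [layeredWeight_cell_ae s m] with t ht
    simp only [hG, ht]
  have hGm : ∀ m : ℤ, Integrable (fun t : ℝ => G (m + t)) (volume.restrict (Icc 0 1)) := fun m =>
    ((measurePreserving_cell m).integrable_comp_emb (measurableEmbedding_cell m)).2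
      hGi.integrableOn
  constructor
  · intro m
    have h1 := ((hGm m).congr (hcell m)).smul (cellWeight s m)⁻¹
    simpa [Pi.smul_def, smul_smul, inv_mul_cancel₀ (cellWeight_pos hs m).ne'] using h1
  · have h1 := hasSum_integral_iUnion (fun m : ℤ => measurableSet_Ico)
      (pairwise_disjoint_Ico_intCast ℝ) (μ := volume) (f := G) hGi.integrableOn
    rw [iUnion_Ico_intCast, setIntegral_univ, e, integral_indicator hI] at h1
    convert h1 using 2 with m
    rw [← integral_smul, ← integral_congr_ae (hcell m), e]
    exact (measurePreserving_cell m).integral_comp (measurableEmbedding_cell m) _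

theorem memLp_cell (hs : ∀ n, 0 < s n) {I : Set ℝ} (hI : MeasurableSet I)
    (x : WeightedL2 (layeredWeight s) I) (m : ℤ) :
    MemLp (fun t : ℝ => I.indicator x (m + t)) 2 (volume.restrict (Icc 0 1)) := by
  have hx := Lp.memLp x
  have hac : volume.restrict I ≪ weightedMeasure (layeredWeight s) I :=
    withDensity_absolutelyContinuous' (measurable_layeredWeight s).ennreal_ofReal.aemeasurable
      (.of_forall fun x => (ENNReal.ofReal_pos.2 (layeredWeight_pos hs x)).ne')
  have hmeas : AEStronglyMeasurable (I.indicator x) volume :=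
    (aestronglyMeasurable_indicator_iff hI).2 (hx.1.mono_ac hac)
  have hmeas' : AEStronglyMeasurable (fun t : ℝ => I.indicator x (m + t))
      (volume.restrict (Icc 0 1)) :=
    hmeas.restrict.comp_measurePreserving (measurePreserving_cell m)
  rw [memLp_two_iff_integrable_sq_norm hmeas']
  have := (hasSum_integral_cells hs hI ((memLp_two_iff_integrable_sq_norm hx.1).1 hx)).1 m
  refine this.congr (.of_forall fun t => ?_)
  by_cases h : (m + t : ℝ) ∈ I <;> simp [h]

/-- The restriction of an element of `L²(I; μ)`, extended by zero off `I`, to the cell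
`[m, m + 1]`, moved to the unit interval. -/
noncomputable def cellRestrict (hs : ∀ n, 0 < s n) {I : Set ℝ} (hI : MeasurableSet I) (m : ℤ) :
    WeightedL2 (layeredWeight s) I →ₗ[ℂ] UnitL2 where
  toFun x := (memLp_cell hs hI x m).toLp _
  map_add' x y := by
    rw [← MemLp.toLp_add]
    refine MemLp.toLp_congr _ _ ?_
    filter_upwards [(ae_weightedMeasure_iff hs hI).1 (Lp.coeFn_add x y) m] with t ht
    by_cases h : (m + t : ℝ) ∈ I
    · simpa [h] using ht h
    · simp [h]
  map_smul' c x := by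
    rw [RingHom.id_apply, ← MemLp.toLp_const_smul]
    refine MemLp.toLp_congr _ _ ?_
    filter_upwards [(ae_weightedMeasure_iff hs hI).1 (Lp.coeFn_smul c x) m] with t ht
    by_cases h : (m + t : ℝ) ∈ I
    · simpa [h] using ht h
    · simp [h]

theorem coeFn_cellRestrict (hs : ∀ n, 0 < s n) {I : Set ℝ} (hI : MeasurableSet I) (m : ℤ)
    (x : WeightedL2 (layeredWeight s) I) : cellRestrict hs hI m x =ᵐ[volume.restrict (Icc 0 1)]
      fun t : ℝ => I.indicator x (m + t) :=
  (memLp_cell hs hI x m).coeFn_toLp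

theorem hasSum_inner_cellRestrict (hs : ∀ n, 0 < s n) {I : Set ℝ} (hI : MeasurableSet I)
    (x y : WeightedL2 (layeredWeight s) I) :
    HasSum (fun m : ℤ => (cellWeight s m : ℂ) *
      inner ℂ (cellRestrict hs hI m x) (cellRestrict hs hI m y)) (inner ℂ x y) := by
  rw [L2.inner_def]
  have h := (hasSum_integral_cells hs hI (L2.integrable_inner (𝕜 := ℂ) x y)).2
  refine h.congr_fun fun m => ?_
  rw [L2.inner_def, Complex.real_smul]
  congr 1
  refine integral_congr_ae ?_
  filter_upwards [coeFn_cellRestrict hs hI m x, coeFn_cellRestrict hs hI m y] with t h1 h2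
  by_cases h : (m + t : ℝ) ∈ I <;> simp [h, h1, h2]

theorem hasSum_norm_sq_cellRestrict (hs : ∀ n, 0 < s n) {I : Set ℝ} (hI : MeasurableSet I)
    (x : WeightedL2 (layeredWeight s) I) :
    HasSum (fun m : ℤ => cellWeight s m * ‖cellRestrict hs hI m x‖ ^ 2) (‖x‖ ^ 2) := by
  have h := hasSum_inner_cellRestrict hs hI x x
  simp only [inner_self_eq_norm_sq_to_K] at h
  exact RCLike.hasSum_ofReal ℂ |>.1 (by simpa using h)

theorem cellRestrict_eq_zero (hs : ∀ n, 0 < s n) {I : Set ℝ} (hI : MeasurableSet I) {m : ℤ}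
    (hm : ∀ t ∈ Ioo (0 : ℝ) 1, (m + t : ℝ) ∉ I) (x : WeightedL2 (layeredWeight s) I) :
    cellRestrict hs hI m x = 0 := by
  rw [Lp.eq_zero_iff_ae_eq_zero]
  have h1 : ∀ᵐ t ∂(volume.restrict (Icc (0 : ℝ) 1)), t ∈ Ioo (0 : ℝ) 1 := by
    rw [← restrict_Ioo_eq_restrict_Icc]
    exact ae_restrict_mem measurableSet_Ioo
  filter_upwards [coeFn_cellRestrict hs hI m x, h1] with t h2 h3
  rw [h2, indicator_of_notMem (hm t h3)]
  rfl

theorem memLp_cellExtend (h : UnitL2) (I : Set ℝ) (m : ℤ) :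
    MemLp ((Ico (m : ℝ) (m + 1)).indicator fun x => h (x - m)) 2
      (weightedMeasure (layeredWeight s) I) := by
  rw [memLp_indicator_iff_restrict measurableSet_Ico]
  have h1 : MemLp (fun x : ℝ => h (x - m)) 2 (volume.restrict (Ico (m : ℝ) (m + 1))) := by
    rw [← (measurePreserving_cell m).map_eq, (measurableEmbedding_cell m).memLp_map_measure_iff]
    simpa [Function.comp_def] using Lp.memLp h
  refine (h1.smul_measure (c := ENNReal.ofReal (cellWeight s m))
    ENNReal.ofReal_ne_top).mono_measure ?_
  rw [weightedMeasure, restrict_withDensity measurableSet_Ico, ← withDensity_const]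
  refine (withDensity_mono (g := fun _ => ENNReal.ofReal (cellWeight s m)) ?_).trans
    (Measure.le_iff.2 fun A hA => ?_)
  · filter_upwards [ae_restrict_mem measurableSet_Ico] with x hx
    rw [layeredWeight_eq s hx]
    rfl
  · rw [withDensity_apply _ hA, withDensity_apply _ hA]
    exact lintegral_mono' (Measure.restrict_mono_measure
      (Measure.restrict_mono_measure Measure.restrict_le_self _) _) le_rfl

/-- A function on the unit interval, moved to the cell `[m, m + 1)` and extended by zero. -/
noncomputable def cellExtend (s : ℤ → ℕ) (I : Set ℝ) (m : ℤ) (h : UnitL2) :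
    WeightedL2 (layeredWeight s) I :=
  (memLp_cellExtend h I m).toLp _

theorem cellRestrict_cellExtend (hs : ∀ n, 0 < s n) {I : Set ℝ} (hI : MeasurableSet I) {m : ℤ}
    (hm : ∀ t ∈ Icc (0 : ℝ) 1, (m + t : ℝ) ∈ I) (k : ℤ) (h : UnitL2) :
    cellRestrict hs hI k (cellExtend s I m h) = if k = m then h else 0 := by
  refine Lp.ext ?_
  have h1 : ∀ᵐ t ∂(volume.restrict (Icc (0 : ℝ) 1)), t ∈ Ico (0 : ℝ) 1 := by
    rw [← restrict_Ico_eq_restrict_Icc]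
    exact ae_restrict_mem measurableSet_Ico
  filter_upwards [coeFn_cellRestrict hs hI k (cellExtend s I m h), h1,
    (ae_weightedMeasure_iff hs hI).1 (memLp_cellExtend (s := s) h I m).coeFn_toLp k,
    Lp.coeFn_zero ℂ 2 (volume.restrict (Icc (0 : ℝ) 1))] with t a1 a2 a3 a4
  rw [a1]
  split_ifs with hk
  · subst hk
    have ht := hm t (Ico_subset_Icc_self a2)
    rw [indicator_of_mem ht, cellExtend, a3 ht, indicator_of_mem]
    · simp
    · exact ⟨by linarith [a2.1], by linarith [a2.2]⟩
  · rw [a4]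
    by_cases ht : (k + t : ℝ) ∈ I
    · rw [indicator_of_mem ht, cellExtend, a3 ht, indicator_of_notMem]
      · rfl
      · rintro ⟨b1, b2⟩
        apply hk
        have c1 : (m : ℝ) < k + 1 := by linarith [a2.2]
        have c2 : (k : ℝ) < m + 1 := by linarith [a2.1]
        have c1' : m < k + 1 := by exact_mod_cast c1
        have c2' : k < m + 1 := by exact_mod_cast c2
        omega
    · rw [indicator_of_notMem ht]; rfl

end

/-! ### Gluing absolutely continuous functions along the integers -/

/-- Absolutely continuous functions on the unit cells with matching values at the integers glue to
an absolutely continuous function on the line. -/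
theorem exists_glue {w r : ℤ → ℝ → ℂ} (h : ∀ m, IsACWithDeriv (Icc 0 1) (w m) (r m))
    (hc : ∀ m, w m 1 = w (m + 1) 0) :
    ∃ W W' : ℝ → ℂ, IsACWithDeriv univ W W' ∧ (∀ (m : ℤ), ∀ t ∈ Icc (0 : ℝ) 1, W (m + t) = w m t) ∧
      ∀ (m : ℤ), ∀ t ∈ Ico (0 : ℝ) 1, W' (m + t) = r m t := by
  have hfl : ∀ (m : ℤ), ∀ t ∈ Ico (0 : ℝ) 1, ⌊(m + t : ℝ)⌋ = m := fun m t ht =>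
    Int.floor_eq_iff.2 ⟨by linarith [ht.1], by linarith [ht.2]⟩
  have hW' : ∀ (f : ℤ → ℝ → ℂ) (m : ℤ), ∀ t ∈ Ico (0 : ℝ) 1,
      f ⌊(m + t : ℝ)⌋ (m + t - ⌊(m + t : ℝ)⌋) = f m t := fun f m t ht => by
    simp [hfl m t ht]
  set W : ℝ → ℂ := fun x => w ⌊x⌋ (x - ⌊x⌋)
  set W' : ℝ → ℂ := fun x => r ⌊x⌋ (x - ⌊x⌋)
  have hW : ∀ (m : ℤ), ∀ t ∈ Icc (0 : ℝ) 1, W (m + t) = w m t := by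
    intro m t ht
    rcases eq_or_lt_of_le ht.2 with rfl | h1
    · rw [hc m]
      simp [W]
    · exact hW' w m t ⟨ht.1, h1⟩
  have hcell : ∀ (m : ℤ), ∀ t ∈ Icc (0 : ℝ) 1, IncrementIsIntegral W W' m (m + t) := by
    intro m t ht
    have h1 := ((h m).incrementIsIntegral ordConnected_Icc (left_mem_Icc.2 zero_le_one)
      ht).comp_sub_right m
    have h2 : (fun x => r m (x - m)) =ᵐ[volume.restrict (uIoc ((m : ℝ) + 0) (m + t))] W' := by
      have h3 : ∀ᵐ x ∂(volume.restrict (uIoc ((m : ℝ) + 0) (m + t))), x ∈ Ico (m : ℝ) (m + 1) := by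
        have h4 : ∀ᵐ x ∂(volume.restrict (Icc (m : ℝ) (m + 1))), x ∈ Ico (m : ℝ) (m + 1) := by
          rw [← restrict_Ico_eq_restrict_Icc]
          exact ae_restrict_mem measurableSet_Ico
        refine ae_restrict_of_ae_restrict_of_subset ?_ h4
        rw [uIoc_of_le (by linarith [ht.1]), add_zero]
        exact Ioc_subset_Icc_self.trans (Icc_subset_Icc_right (by linarith [ht.2]))
      filter_upwards [h3] with x hx
      have := hW' r m (x - m) ⟨by linarith [hx.1], by linarith [hx.2]⟩
      simpa [W'] using this.symm
    have h5 := h1.congr_ae h2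
    have e0 := hW m 0 (by simp)
    have e1 := hW m t ht
    simp only [add_zero] at h5 e0
    refine ⟨h5.1, ?_⟩
    rw [← h5.2, e0, e1]
    simp
  have hint : ∀ m : ℤ, IncrementIsIntegral W W' 0 m := by
    intro m
    induction m using Int.induction_on with
    | zero => simpa using IncrementIsIntegral.refl W W' 0
    | succ n ih =>
      have := hcell n 1 (by simp)
      simpa using ih.trans this
    | pred n ih =>
      have := hcell (-n - 1) 1 (by simp)
      have e : ((-n - 1 : ℤ) : ℝ) + 1 = ((-n : ℤ) : ℝ) := by push_cast; ring
      rw [e] at this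
      exact ih.trans this.symm
  refine ⟨W, W', .of_incrementIsIntegral_univ fun x => ?_, hW, hW' r⟩
  have := hcell ⌊x⌋ (x - ⌊x⌋) ⟨by linarith [Int.floor_le x], by linarith [Int.lt_floor_add_one x]⟩
  rw [add_sub_cancel] at this
  exact (hint ⌊x⌋).trans this

/-- `I` is the union of the unit cells `[m, m + 1]` with `m ∈ N`, where `N` is all of `ℤ` or a
finite interval, and `B` consists of the endpoints of `I`. -/
structure IsCellUnion (I B : Set ℝ) (N : Set ℤ) : Prop where
  measurableSet : MeasurableSet I
  ordConnected : I.OrdConnected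
  mem : ∀ m ∈ N, ∀ t ∈ Icc (0 : ℝ) 1, (m + t : ℝ) ∈ I
  notMem : ∀ m ∉ N, ∀ t ∈ Ioo (0 : ℝ) 1, (m + t : ℝ) ∉ I
  of_mem_boundary : ∀ z ∈ B, ∃ k : ℤ, z = k ∧ (k ∉ N ∨ k - 1 ∉ N)
  mem_boundary : ∀ k : ℤ, ¬(k ∈ N ↔ k - 1 ∈ N) → (k : ℝ) ∈ B
  shape : N = univ ∨ ∃ k l, k < l ∧ N = Ico k l

theorem isCellUnion_univ : IsCellUnion univ ∅ univ where
  measurableSet := .univ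
  ordConnected := ordConnected_univ
  mem _ _ _ _ := mem_univ _
  notMem m hm := absurd (mem_univ m) hm
  of_mem_boundary z hz := absurd hz (notMem_empty z)
  mem_boundary k hk := absurd (by simp) hk
  shape := .inl rfl

theorem isCellUnion_Icc {k l : ℤ} (hkl : k < l) :
    IsCellUnion (Icc (k : ℝ) l) {(k : ℝ), (l : ℝ)} (Ico k l) where
  measurableSet := measurableSet_Icc
  ordConnected := ordConnected_Icc
  mem m hm t ht := by
    have h1 : (k : ℝ) ≤ m := by exact_mod_cast hm.1
    have h2 : (m : ℝ) + 1 ≤ l := by exact_mod_cast hm.2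
    exact ⟨by linarith [ht.1], by linarith [ht.2]⟩
  notMem m hm t ht := by
    rintro ⟨h1, h2⟩
    apply hm
    have h3 : (k : ℝ) < m + 1 := by linarith [ht.2]
    have h4 : (m : ℝ) < l := by linarith [ht.1]
    have h3' : k < m + 1 := by exact_mod_cast h3
    exact ⟨by omega, by exact_mod_cast h4⟩
  of_mem_boundary z hz := by
    rcases hz with rfl | rfl
    · exact ⟨k, rfl, .inr fun h => by have := h.1; omega⟩
    · exact ⟨l, rfl, .inl fun h => by have := h.2; omega⟩
  mem_boundary m hm := by
    simp only [mem_Ico] at hm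
    have : m = k ∨ m = l := by omega
    rcases this with rfl | rfl <;> simp
  shape := .inr ⟨k, l, hkl, rfl⟩

/-- A family of absolutely continuous functions on the cells in `N` with matching values extends
to all cells, by constants. -/
theorem IsCellUnion.exists_extension {I B : Set ℝ} {N : Set ℤ} (hN : IsCellUnion I B N)
    {p p' : ℤ → ℝ → ℂ} (h : ∀ m ∈ N, IsACWithDeriv (Icc 0 1) (p m) (p' m))
    (hc : ∀ m, m ∈ N → m + 1 ∈ N → p m 1 = p (m + 1) 0) :
    ∃ q q' : ℤ → ℝ → ℂ, (∀ m, IsACWithDeriv (Icc 0 1) (q m) (q' m)) ∧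
      (∀ m ∈ N, q m = p m ∧ q' m = p' m) ∧ ∀ m, q m 1 = q (m + 1) 0 := by
  rcases hN.shape with rfl | ⟨k, l, hkl, rfl⟩
  · exact ⟨p, p', fun m => h m (mem_univ m), fun m _ => ⟨rfl, rfl⟩,
      fun m => hc m (mem_univ _) (mem_univ _)⟩
  · have hconst : ∀ c : ℂ, IsACWithDeriv (Icc 0 1) (fun _ => c) 0 := fun c =>
      .of_hasDerivAt zero_le_one (fun t => hasDerivAt_const t c) continuous_const
    refine ⟨fun m => if m < k then fun _ => p k 0 else if m < l then p m else fun _ => p (l - 1) 1,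
      fun m => if m < k then 0 else if m < l then p' m else 0, fun m => ?_, fun m hm => ?_,
      fun m => ?_⟩
    · dsimp only
      split_ifs with h1 h2
      · exact hconst _
      · exact h m ⟨not_lt.1 h1, h2⟩
      · exact hconst _
    · simp [not_lt.2 hm.1, hm.2]
    · dsimp only
      rcases lt_trichotomy (m + 1) k with h1 | h1 | h1
      · have a1 : m < k := by omega
        simp only [a1, h1, if_true]
      · have a1 : m < k := by omega
        simp only [a1, h1, hkl, lt_irrefl, if_true, if_false]
      · have a1 : ¬m < k := by omega
        have a2 : ¬m + 1 < k := by omega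
        rcases lt_trichotomy (m + 1) l with h2 | h2 | h2
        · have a3 : m < l := by omega
          simp only [a1, a2, a3, h2, if_true, if_false]
          exact hc m ⟨by omega, by omega⟩ ⟨by omega, by omega⟩
        · have a3 : m < l := by omega
          have a4 : ¬m + 1 < l := by omega
          simp only [a1, a2, a3, a4, if_true, if_false]
          rw [← h2, add_sub_cancel_right]
        · have a3 : ¬m < l := by omega
          have a4 : ¬m + 1 < l := by omega
          simp only [a1, a2, a3, a4, if_false]

/-! ### Sturm–Liouville operators with a piecewise constant weight -/

/-- Boundary values on the unit cells which are continuous across the integers, vanish off the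
cells in `N`, and have continuous quasi-derivative `μ f'` inside `N`. The first two conditions
together contain the Dirichlet condition at the endpoints of `N`. -/
structure IsMatched (s : ℤ → ℕ) (N : Set ℤ) (γ : ℤ → Fin 4 → ℂ) : Prop where
  eq_zero : ∀ m ∉ N, γ m = 0
  value : ∀ m, γ m 1 = γ (m + 1) 0
  flux : ∀ m, m ∈ N → m + 1 ∈ N →
    (cellWeight s m : ℂ) * γ m 3 = (cellWeight s (m + 1) : ℂ) * γ (m + 1) 2

theorem ae_mem_Ioo_zero_one : ∀ᵐ t ∂(volume.restrict (Icc (0 : ℝ) 1)), t ∈ Ioo (0 : ℝ) 1 := by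
  rw [← restrict_Ioo_eq_restrict_Icc]
  exact ae_restrict_mem measurableSet_Ioo

/-- The operator `τ` with Dirichlet conditions, in terms of unit cells: on each cell it is the
maximal operator `w ↦ -w''`, and the boundary values on neighbouring cells match. -/
theorem mem_sturmLiouvilleGraph_iff {s : ℤ → ℕ} (hs : ∀ n, 0 < s n) {I B : Set ℝ} {N : Set ℤ}
    (hN : IsCellUnion I B N) (x y : WeightedL2 (layeredWeight s) I) :
    (x, y) ∈ sturmLiouvilleGraph (layeredWeight s) I B ↔
      ∃ γ : ℤ → Fin 4 → ℂ, IsMatched s N γ ∧ ∀ m ∈ N,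
        (cellRestrict hs hN.measurableSet m x, cellRestrict hs hN.measurableSet m y, γ m) ∈
          unitTriples := by
  have hI := hN.measurableSet
  have hω : ∀ m, (cellWeight s m : ℂ) ≠ 0 := fun m => by
    exact_mod_cast (cellWeight_pos hs m).ne'
  constructor
  · rintro ⟨u, u', p, p', hu, hp, hf, hpu, hg, hB⟩
    have hshift : ∀ {f f' : ℝ → ℂ}, IsACWithDeriv I f f' → ∀ m ∈ N, ∀ t ∈ Icc (0 : ℝ) 1,
        IncrementIsIntegral (fun t => f (m + t)) (fun t => f' (m + t)) 0 t := by
      intro f f' hf m hm t ht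
      exact (hf.incrementIsIntegral hN.ordConnected (hN.mem m hm 0 (by simp))
        (hN.mem m hm t ht)).comp_add_left m
    classical
    refine ⟨fun m => if m ∈ N then
      ![u m, u (m + 1), p m / cellWeight s m, p (m + 1) / cellWeight s m] else 0,
      ⟨fun m hm => by simp [hm], fun m => ?_, fun m h1 h2 => ?_⟩, fun m hm => ?_⟩
    · by_cases h1 : m ∈ N <;> by_cases h2 : m + 1 ∈ N
      · simp [h1, h2]
      · have := hB _ (hN.mem_boundary (m + 1) (by simp [h1, h2]))
        simp only [Int.cast_add, Int.cast_one] at this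
        simp [h1, h2, this]
      · have := hB _ (hN.mem_boundary (m + 1) (by simp [h1, h2]))
        simp only [Int.cast_add, Int.cast_one] at this
        simp [h1, h2, this]
      · simp [h1, h2]
    · simp [h1, h2, mul_div_cancel₀ _ (hω _)]
    · dsimp only
      rw [if_pos hm]
      refine ⟨fun t => u (m + t), fun t => p (m + t) / cellWeight s m,
        fun t => p' (m + t) / cellWeight s m, ?_, ?_, ?_, ?_, by simp⟩
      · refine .of_incrementIsIntegral_Icc zero_le_one fun t ht => (hshift hu m hm t ht).congr_ae ?_
        have : uIoc 0 t ⊆ Icc 0 1 := by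
          rw [uIoc_of_le ht.1]
          exact Ioc_subset_Icc_self.trans (Icc_subset_Icc_right ht.2)
        refine ae_restrict_of_ae_restrict_of_subset this ?_
        filter_upwards [(ae_restrict_iff_forall_cell hI).1 hpu m, layeredWeight_cell_ae s m,
          ae_restrict_mem measurableSet_Icc] with z h1 h2 h3
        rw [h1 (hN.mem m hm z h3), h2, mul_div_cancel_left₀ _ (hω m)]
      · refine .of_incrementIsIntegral_Icc zero_le_one fun t ht => ?_
        have := (hshift hp m hm t ht).const_smul (cellWeight s m : ℂ)⁻¹
        simpa only [Pi.smul_def, smul_eq_mul, inv_mul_eq_div] using this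
      · filter_upwards [coeFn_cellRestrict hs hI m x, (ae_weightedMeasure_iff hs hI).1 hf m,
          ae_restrict_mem measurableSet_Icc] with t h1 h2 h3
        have h4 := hN.mem m hm t h3
        rw [h1, indicator_of_mem h4, h2 h4]
      · filter_upwards [coeFn_cellRestrict hs hI m y, (ae_weightedMeasure_iff hs hI).1 hg m,
          ae_restrict_mem measurableSet_Icc, layeredWeight_cell_ae s m] with t h1 h2 h3 h5
        have h4 := hN.mem m hm t h3
        rw [h1, indicator_of_mem h4, h2 h4, h5]
        simp only [Pi.neg_apply]
        ring
  · rintro ⟨γ, hγ, hT⟩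
    have hT' : ∀ m, ∃ w r v : ℝ → ℂ, IsACWithDeriv (Icc 0 1) w r ∧ IsACWithDeriv (Icc 0 1) r v ∧
        γ m = ![w 0, w 1, r 0, r 1] ∧ (m ∈ N →
          cellRestrict hs hI m x =ᵐ[volume.restrict (Icc 0 1)] w ∧
          cellRestrict hs hI m y =ᵐ[volume.restrict (Icc 0 1)] -v) := by
      intro m
      by_cases hm : m ∈ N
      · obtain ⟨w, r, v, h1, h2, h3, h4, h5⟩ := hT m hm
        exact ⟨w, r, v, h1, h2, h5, fun _ => ⟨h3, h4⟩⟩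
      · refine ⟨0, 0, 0, .zero _, .zero _, ?_, fun h => absurd h hm⟩
        rw [hγ.eq_zero m hm]
        ext i; fin_cases i <;> rfl
    choose w r v hw hr hγv hxy using hT'
    -- Off `N` the function `u` is extended by zero, but `μ u'` need not vanish at the endpoints of
    -- `I` and is extended by constants.
    obtain ⟨W, W', hWac, hW, hW'⟩ := exists_glue hw fun m => by
      have := hγ.value m
      simpa [hγv] using this
    obtain ⟨q, q', hq, hqp, hqc⟩ := hN.exists_extension (p := fun m => (cellWeight s m : ℂ) • r m)
      (p' := fun m => (cellWeight s m : ℂ) • v m) (fun m _ => (hr m).smul _) fun m h1 h2 => by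
        have := hγ.flux m h1 h2
        simpa [hγv] using this
    obtain ⟨Q, Q', hQac, hQ, hQ'⟩ := exists_glue hq hqc
    have hcell : ∀ {P : ℤ → ℝ → Prop},
        (∀ m ∈ N, ∀ᵐ t ∂(volume.restrict (Icc (0 : ℝ) 1)), t ∈ Ioo (0 : ℝ) 1 → P m t) →
        ∀ m : ℤ, ∀ᵐ t ∂(volume.restrict (Icc (0 : ℝ) 1)), (m + t : ℝ) ∈ I → P m t := by
      intro P h m
      by_cases hm : m ∈ N
      · filter_upwards [h m hm, ae_mem_Ioo_zero_one] with t h1 h2 _ using h1 h2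
      · filter_upwards [ae_mem_Ioo_zero_one] with t h2 h3 using absurd h3 (hN.notMem m hm t h2)
    refine ⟨W, W', Q, Q', hWac.mono (subset_univ _), hQac.mono (subset_univ _), ?_, ?_, ?_, ?_⟩
    · refine (ae_weightedMeasure_iff hs hI).2 (hcell fun m hm => ?_)
      filter_upwards [(hxy m hm).1, coeFn_cellRestrict hs hI m x] with t h1 h2 h3
      have h4 := hN.mem m hm t (Ioo_subset_Icc_self h3)
      rw [hW m t (Ioo_subset_Icc_self h3), ← h1, h2, indicator_of_mem h4]
    · refine (ae_restrict_iff_forall_cell hI).2 (hcell fun m hm => ?_)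
      filter_upwards [layeredWeight_cell_ae s m] with t h1 h3
      rw [hQ m t (Ioo_subset_Icc_self h3), hW' m t (Ioo_subset_Ico_self h3), h1, (hqp m hm).1]
      rfl
    · refine (ae_weightedMeasure_iff hs hI).2 (hcell fun m hm => ?_)
      filter_upwards [(hxy m hm).2, coeFn_cellRestrict hs hI m y, layeredWeight_cell_ae s m]
        with t h1 h2 h5 h3
      have h4 := hN.mem m hm t (Ioo_subset_Icc_self h3)
      rw [indicator_of_mem h4] at h2
      rw [hQ' m t (Ioo_subset_Ico_self h3), h5, (hqp m hm).2, ← h2, h1]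
      simp only [Pi.neg_apply, Pi.smul_apply, smul_eq_mul]
      field_simp [hω m]
    · intro z hz
      obtain ⟨k, rfl, hk⟩ := hN.of_mem_boundary z hz
      have h0 : W k = γ k 0 := by
        have := hW k 0 (by simp)
        rw [add_zero] at this
        simp [this, hγv]
      rw [h0]
      rcases hk with hk | hk
      · simp [hγ.eq_zero k hk]
      · have := hγ.value (k - 1)
        rw [sub_add_cancel] at this
        simp [← this, hγ.eq_zero (k - 1) hk]

/-! ### Self-adjointness of the full-line operator -/

section

variable {s : ℤ → ℕ}

theorem inner_cellExtend (hs : ∀ n, 0 < s n) {I : Set ℝ} (hI : MeasurableSet I) {m : ℤ}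
    (hm : ∀ t ∈ Icc (0 : ℝ) 1, (m + t : ℝ) ∈ I) (y : UnitL2) (g : WeightedL2 (layeredWeight s) I) :
    inner ℂ (cellExtend s I m y) g =
      (cellWeight s m : ℂ) * inner ℂ y (cellRestrict hs hI m g) := by
  refine (hasSum_inner_cellRestrict hs hI (cellExtend s I m y) g).unique ?_
  convert hasSum_single m fun k hk => ?_ using 1
  · simp [cellRestrict_cellExtend hs hI hm]
  · simp [cellRestrict_cellExtend hs hI hm, hk]

theorem mem_lineGraph_iff (hs : ∀ n, 0 < s n) (x y : WeightedL2 (layeredWeight s) univ) :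
    (x, y) ∈ sturmLiouvilleGraph (layeredWeight s) univ ∅ ↔
      ∃ γ : ℤ → Fin 4 → ℂ, (∀ m, γ m 1 = γ (m + 1) 0) ∧
        (∀ m, (cellWeight s m : ℂ) * γ m 3 = (cellWeight s (m + 1) : ℂ) * γ (m + 1) 2) ∧
        ∀ m, (cellRestrict hs .univ m x, cellRestrict hs .univ m y, γ m) ∈ unitTriples := by
  rw [mem_sturmLiouvilleGraph_iff hs isCellUnion_univ]
  constructor
  · rintro ⟨γ, h1, h2⟩
    exact ⟨γ, h1.value, fun m => h1.flux m (mem_univ _) (mem_univ _), fun m => h2 m (mem_univ m)⟩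
  · rintro ⟨γ, h1, h2, h3⟩
    exact ⟨γ, ⟨fun m hm => absurd (mem_univ m) hm, h1, fun m _ _ => h2 m⟩, fun m _ => h3 m⟩

theorem exists_boundary_form_bound : ∃ C : ℝ, ∀ (x y x₂ y₂ : UnitL2) (γ δ : Fin 4 → ℂ),
    (x, y, γ) ∈ unitTriples → (x₂, y₂, δ) ∈ unitTriples →
    ‖star (γ 0) * δ 2 - star (γ 2) * δ 0‖ ≤
      C * (‖x‖ ^ 2 + ‖y‖ ^ 2 + (‖x₂‖ ^ 2 + ‖y₂‖ ^ 2)) := by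
  obtain ⟨C, hC, hb⟩ := exists_boundary_bound
  refine ⟨2 * C ^ 2, fun x y x₂ y₂ γ δ h h₂ => ?_⟩
  have a0 := hb _ _ _ h 0
  have a2 := hb _ _ _ h 2
  have b0 := hb _ _ _ h₂ 0
  have b2 := hb _ _ _ h₂ 2
  refine (norm_sub_le _ _).trans ?_
  rw [norm_mul, norm_mul, norm_star, norm_star]
  have c1 := mul_le_mul a0 b2 (norm_nonneg _) (by positivity)
  have c2 := mul_le_mul a2 b0 (norm_nonneg _) (by positivity)
  have c3 : (‖x‖ + ‖y‖) * (‖x₂‖ + ‖y₂‖) ≤ ‖x‖ ^ 2 + ‖y‖ ^ 2 + (‖x₂‖ ^ 2 + ‖y₂‖ ^ 2) := by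
    nlinarith [sq_nonneg (‖x‖ - ‖y‖), sq_nonneg (‖x₂‖ - ‖y₂‖),
      sq_nonneg (‖x‖ + ‖y‖ - (‖x₂‖ + ‖y₂‖))]
  have c4 := mul_le_mul_of_nonneg_left c3 (sq_nonneg C)
  linarith

/-- The full-line operator is symmetric. The boundary terms in Green's identity telescope, and
they are summable because each is bounded by the graph norms on its cell, so that their
differences sum to zero: this is the limit point property at `±∞`. -/
theorem lineGraph_symmetric (hs : ∀ n, 0 < s n) {x y x₂ y₂ : WeightedL2 (layeredWeight s) univ}
    (h : (x, y) ∈ sturmLiouvilleGraph (layeredWeight s) univ ∅)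
    (h₂ : (x₂, y₂) ∈ sturmLiouvilleGraph (layeredWeight s) univ ∅) :
    inner ℂ y x₂ = inner ℂ x y₂ := by
  obtain ⟨γ, hv, hf, hT⟩ := (mem_lineGraph_iff hs x y).1 h
  obtain ⟨δ, kv, kf, kT⟩ := (mem_lineGraph_iff hs x₂ y₂).1 h₂
  set l : ℤ → ℂ := fun m => cellWeight s m * (star (γ m 0) * δ m 2 - star (γ m 2) * δ m 0) with hl
  have hterm : ∀ m, (cellWeight s m : ℂ) * inner ℂ (cellRestrict hs .univ m y)
        (cellRestrict hs .univ m x₂) - (cellWeight s m : ℂ) * inner ℂ (cellRestrict hs .univ m x)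
        (cellRestrict hs .univ m y₂) = l (m + 1) - l m := by
    intro m
    rw [← mul_sub, unitTriples_green (hT m) (kT m)]
    have e1 : (cellWeight s m : ℂ) * star (γ m 3) = cellWeight s (m + 1) * star (γ (m + 1) 2) := by
      simpa using congrArg star (hf m)
    simp only [hl, ← hv m, ← kv m]
    linear_combination star (γ m 1) * kf m - δ m 1 * e1
  have hD := ((hasSum_inner_cellRestrict hs .univ y x₂).sub
    (hasSum_inner_cellRestrict hs .univ x y₂)).congr_fun fun m => (hterm m).symm
  obtain ⟨C, hb⟩ := exists_boundary_form_bound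
  have hsum : Summable l := by
    have hS := (((hasSum_norm_sq_cellRestrict hs .univ x).summable.add
      (hasSum_norm_sq_cellRestrict hs .univ y).summable).add
      ((hasSum_norm_sq_cellRestrict hs .univ x₂).summable.add
      (hasSum_norm_sq_cellRestrict hs .univ y₂).summable)).mul_left C
    refine hS.of_norm_bounded fun m => ?_
    have hw := (cellWeight_pos hs m).le
    rw [hl, norm_mul, Complex.norm_real, Real.norm_of_nonneg hw]
    refine (mul_le_mul_of_nonneg_left (hb _ _ _ _ _ _ (hT m) (kT m)) hw).trans (le_of_eq ?_)
    ring
  have hshift : HasSum (fun m => l (m + 1)) (∑' m, l m) :=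
    (Equiv.addRight (1 : ℤ)).hasSum_iff.2 hsum.hasSum
  have h0 := hD.unique (hshift.sub hsum.hasSum)
  rw [sub_self] at h0
  exact sub_eq_zero.1 h0

/-- A pair in the adjoint relation of the full-line operator belongs to its graph: testing with
functions supported in one cell gives regularity there, testing with cubic splines supported in
two neighbouring cells gives the matching conditions. -/
theorem mem_lineGraph_of_weak (hs : ∀ n, 0 < s n) {g h : WeightedL2 (layeredWeight s) univ}
    (H : ∀ x y, (x, y) ∈ sturmLiouvilleGraph (layeredWeight s) univ ∅ →
      inner ℂ y g = inner ℂ x h) :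
    (g, h) ∈ sturmLiouvilleGraph (layeredWeight s) univ ∅ := by
  have hω : ∀ m, (cellWeight s m : ℂ) ≠ 0 := fun m => by
    exact_mod_cast (cellWeight_pos hs m).ne'
  have hR : ∀ (k m : ℤ) (x : UnitL2), cellRestrict hs .univ k (cellExtend s univ m x) =
      if k = m then x else 0 := fun k m x =>
    cellRestrict_cellExtend hs .univ (fun _ _ => mem_univ _) k x
  have hi : ∀ (m : ℤ) (y : UnitL2) (g : WeightedL2 (layeredWeight s) univ),
      inner ℂ (cellExtend s univ m y) g =
        (cellWeight s m : ℂ) * inner ℂ y (cellRestrict hs .univ m g) := fun m y g =>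
    inner_cellExtend hs .univ (fun _ _ => mem_univ _) y g
  have hex : ∀ m, ∃ γ, (cellRestrict hs .univ m g, cellRestrict hs .univ m h, γ) ∈ unitTriples := by
    intro m
    refine exists_unitTriples_of_weak fun x y hxy => ?_
    have := H (cellExtend s univ m x) (cellExtend s univ m y) <| by
      refine (mem_lineGraph_iff hs _ _).2 ⟨0, fun _ => rfl, fun _ => by simp, fun k => ?_⟩
      rw [hR, hR]
      split_ifs
      · exact hxy
      · exact zero_mem _
    rw [hi, hi] at this
    exact mul_left_cancel₀ (hω m) this
  choose γ hγ using hex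
  -- The test function has value `α` and quasi-derivative `β` at the common vertex of the cells `k`
  -- and `k + 1`, and vanishes to second order at their other endpoints.
  have hmatch : ∀ (k : ℤ) (α β : ℂ),
      star α * (cellWeight s k * γ k 3 - cellWeight s (k + 1) * γ (k + 1) 2) -
        star β * (γ k 1 - γ (k + 1) 0) = 0 := by
    intro k α β
    obtain ⟨x₁, y₁, h₁⟩ := exists_unitTriples_of_boundary ![0, α, 0, β / cellWeight s k]
    obtain ⟨x₂, y₂, h₂⟩ := exists_unitTriples_of_boundary ![α, 0, β / cellWeight s (k + 1), 0]
    have := H (cellExtend s univ k x₁ + cellExtend s univ (k + 1) x₂)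
      (cellExtend s univ k y₁ + cellExtend s univ (k + 1) y₂) <| by
      refine (mem_lineGraph_iff hs _ _).2 ⟨fun m =>
        (if m = k then ![0, α, 0, β / cellWeight s k] else 0) +
          (if m = k + 1 then ![α, 0, β / cellWeight s (k + 1), 0] else 0),
        fun m => ?_, fun m => ?_, fun m => ?_⟩
      · by_cases e1 : m = k
        · simp [e1]
        · by_cases e2 : m = k + 1
          · have e4 : ¬k + 1 + 1 = k := by omega
            simp [e2, e4]
          · by_cases e3 : m + 1 = k
            · simp [e1, e2, e3]
            · simp [e1, e2, e3]
      · by_cases e1 : m = k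
        · simp [e1, mul_div_cancel₀ _ (hω _)]
        · by_cases e2 : m = k + 1
          · have e4 : ¬k + 1 + 1 = k := by omega
            simp [e2, e4]
          · by_cases e3 : m + 1 = k
            · simp [e1, e2, e3]
            · simp [e1, e2, e3]
      · rw [map_add, map_add, hR, hR, hR, hR]
        have e1 : ((if m = k then x₁ else 0, if m = k then y₁ else 0,
            if m = k then ![0, α, 0, β / cellWeight s k] else 0) :
            UnitL2 × UnitL2 × (Fin 4 → ℂ)) ∈ unitTriples := by
          split_ifs
          · exact h₁
          · exact zero_mem _
        have e2 : ((if m = k + 1 then x₂ else 0, if m = k + 1 then y₂ else 0,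
            if m = k + 1 then ![α, 0, β / cellWeight s (k + 1), 0] else 0) :
            UnitL2 × UnitL2 × (Fin 4 → ℂ)) ∈ unitTriples := by
          split_ifs
          · exact h₂
          · exact zero_mem _
        exact add_mem e1 e2
    rw [inner_add_left, inner_add_left, hi, hi, hi, hi] at this
    have g1 := unitTriples_green h₁ (hγ k)
    have g2 := unitTriples_green h₂ (hγ (k + 1))
    simp at g1 g2
    have w1 := hω k
    have w2 := hω (k + 1)
    have f1 : (cellWeight s k : ℂ) * (star β / cellWeight s k) = star β := mul_div_cancel₀ _ w1
    have f2 : (cellWeight s (k + 1) : ℂ) * (star β / cellWeight s (k + 1)) = star β :=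
      mul_div_cancel₀ _ w2
    simp only [RCLike.star_def] at f1 f2 ⊢
    linear_combination this - cellWeight s k * g1 - cellWeight s (k + 1) * g2 +
      γ k 1 * f1 - γ (k + 1) 0 * f2
  refine (mem_lineGraph_iff hs g h).2 ⟨γ, fun k => ?_, fun k => ?_, hγ⟩
  · have := hmatch k 0 1
    simp [sub_eq_zero] at this
    exact this.symm ▸ rfl
  · have := hmatch k 1 0
    simpa [sub_eq_zero] using this

theorem lineOperator_isSelfAdjoint (hs : ∀ n, 0 < s n) : IsSelfAdjoint (lineOperator s) := by
  have hsv := sturmLiouvilleGraph_singleValued (measurable_layeredWeight s) (layeredWeight_pos hs)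
    convex_univ ∅
  have hgraph : (lineOperator s).graph = sturmLiouvilleGraph (layeredWeight s) univ ∅ :=
    Submodule.toLinearPMap_graph_eq _ hsv
  have hdense : Dense ((lineOperator s).domain : Set (WeightedL2 (layeredWeight s) univ)) := by
    rw [Submodule.dense_iff_topologicalClosure_eq_top, Submodule.topologicalClosure_eq_top_iff,
      Submodule.eq_bot_iff]
    intro g hg
    refine hsv (0, g) (mem_lineGraph_of_weak hs fun x y hxy => ?_) rfl
    rw [inner_zero_right]
    exact (hg x ⟨(x, y), hxy, rfl⟩).symm
  refine LinearPMap.eq_of_eq_graph ?_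
  change (lineOperator s).adjoint.graph = _
  rw [LinearPMap.adjoint_graph_eq_graph_adjoint hdense, hgraph]
  ext ⟨g, h⟩
  rw [Submodule.mem_adjoint_iff]
  constructor
  · intro H
    exact mem_lineGraph_of_weak hs fun x y hxy => sub_eq_zero.1 (H x y hxy)
  · intro H x y hxy
    exact sub_eq_zero.2 (lineGraph_symmetric hs hxy H)

end

/-! ### Fourier bases of the spheres -/

/-- The `j`-th Fourier vector `a ↦ exp (2πi ja / m)` on `m` points; for `j = 0` it is the constant
vector `1`. -/
noncomputable def fourierVector (m j a : ℕ) : ℂ :=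
  Complex.exp (2 * Real.pi * Complex.I / m) ^ (j * a)

@[simp]
theorem fourierVector_zero (m a : ℕ) : fourierVector m 0 a = 1 := by
  simp [fourierVector]

theorem fourierVector_comm (m j a : ℕ) : fourierVector m j a = fourierVector m a j := by
  simp [fourierVector, mul_comm]

theorem sum_fourierVector {m : ℕ} (hm : 0 < m) {j k : ℕ} (hj : j < m) (hk : k < m) :
    ∑ a : Fin m, star (fourierVector m j a) * fourierVector m k a =
      if j = k then (m : ℂ) else 0 := by
  have hζ := Complex.isPrimitiveRoot_exp m hm.ne'
  set ζ := Complex.exp (2 * Real.pi * Complex.I / m) with hdef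
  have hζ0 : ζ ≠ 0 := Complex.exp_ne_zero _
  have hstar : star ζ = ζ⁻¹ := by
    rw [hdef, ← Complex.exp_neg, RCLike.star_def, ← Complex.exp_conj]
    congr 1
    simp [Complex.conj_ofNat]
    ring
  set ξ := ζ ^ k * (ζ ^ j)⁻¹ with hξ
  have hterm : ∀ a : ℕ, star (fourierVector m j a) * fourierVector m k a = ξ ^ a := by
    intro a
    simp only [fourierVector, star_pow, ← hdef, hstar, hξ, mul_pow, inv_pow, ← pow_mul]
    ring
  simp only [hterm]
  rw [Fin.sum_univ_eq_sum_range fun a => ξ ^ a]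
  split_ifs with h
  · subst h
    have : ξ = 1 := mul_inv_cancel₀ (pow_ne_zero _ hζ0)
    simp [this]
  · have h1 : ξ ≠ 1 := by
      intro h1
      have : ζ ^ k = ζ ^ j := by
        rwa [hξ, mul_inv_eq_one₀ (pow_ne_zero _ hζ0)] at h1
      exact h (hζ.pow_inj hk hj this).symm
    have hm1 : ξ ^ m = 1 := by
      rw [hξ, mul_pow, inv_pow, ← pow_mul, ← pow_mul, mul_comm k, mul_comm j, pow_mul, pow_mul,
        hζ.pow_eq_one]
      simp
    have := geom_sum_mul ξ m
    rw [hm1, sub_self] at this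
    exact (mul_eq_zero.1 this).resolve_right (sub_ne_zero.2 h1)

/-! ### Coefficients of the pieces on the edges -/

section

variable {s : ℤ → ℕ}

/-- The value on the edge `e` of the unit of the piece `i`: a function `g` in the space of the piece
corresponds to the function on the metric graph which on `e` is `i.coeff e` times the restriction
of `g` to the layer of `e`. -/
noncomputable def Piece.coeff : Piece s → LayeredEdge s → ℂ
  | .line, _ => 1
  | .one k j, e => if e.1 = k then fourierVector (s e.1) (j + 1) e.2.1
      else if e.1 + 1 = k then fourierVector (s (e.1 + 1)) (j + 1) e.2.2 else 0
  | .two k j, e => if e.1 = k then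
      fourierVector (s e.1) ((finProdFinEquiv.symm j).1 + 1) e.2.1 *
        fourierVector (s (e.1 + 1)) ((finProdFinEquiv.symm j).2 + 1) e.2.2 else 0

/-- The layers on which a piece lives. -/
def Piece.cells : Piece s → Set ℤ
  | .line => univ
  | .one k _ => Ico (k - 1) (k + 1)
  | .two k _ => Ico k (k + 1)

/-- The endpoints of the interval of a piece. -/
def Piece.boundary : Piece s → Set ℝ
  | .line => ∅
  | .one k _ => {(k : ℝ) - 1, (k : ℝ) + 1}
  | .two k _ => {(k : ℝ), (k : ℝ) + 1}

theorem Piece.isCellUnion (i : Piece s) : IsCellUnion i.interval i.boundary i.cells := by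
  cases i with
  | line => exact isCellUnion_univ
  | one k j =>
    have := isCellUnion_Icc (k := k - 1) (l := k + 1) (by omega)
    push_cast at this
    exact this
  | two k j =>
    have := isCellUnion_Icc (k := k) (l := k + 1) (by omega)
    push_cast at this
    exact this

theorem Piece.measurableSet_interval (i : Piece s) : MeasurableSet i.interval :=
  i.isCellUnion.measurableSet

theorem Piece.convex_interval (i : Piece s) : Convex ℝ i.interval :=
  i.isCellUnion.ordConnected.convex

theorem Piece.operator_eq (i : Piece s) :
    i.operator = sturmLiouville (layeredWeight s) i.interval i.boundary := by
  cases i <;> rfl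

theorem Piece.operator_graph (hs : ∀ n, 0 < s n) (i : Piece s) :
    i.operator.graph = sturmLiouvilleGraph (layeredWeight s) i.interval i.boundary := by
  rw [operator_eq]
  exact Submodule.toLinearPMap_graph_eq _ (sturmLiouvilleGraph_singleValued
    (measurable_layeredWeight s) (layeredWeight_pos hs) i.convex_interval _)

/-- The piece spanned on the `n`-th layer by the tensor product of the `j`-th Fourier vector of `Sₙ`
and the `k`-th Fourier vector of `Sₙ₊₁`. -/
def layerPiece (n : ℤ) (p : Fin (s n) × Fin (s (n + 1))) : Piece s :=
  if h₁ : p.1.val = 0 then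
    if h₂ : p.2.val = 0 then .line else .one (n + 1) ⟨p.2 - 1, by omega⟩
  else
    if h₂ : p.2.val = 0 then .one n ⟨p.1 - 1, by omega⟩
    else .two n (finProdFinEquiv (⟨p.1 - 1, by omega⟩, ⟨p.2 - 1, by omega⟩))

theorem coeff_layerPiece (n : ℤ) (p a : Fin (s n) × Fin (s (n + 1))) :
    (layerPiece n p).coeff ⟨n, a⟩ =
      fourierVector (s n) p.1 a.1 * fourierVector (s (n + 1)) p.2 a.2 := by
  unfold layerPiece
  split_ifs with h1 h2 h2
  · simp [Piece.coeff, h1, h2]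
  · simp [Piece.coeff, h1, Nat.sub_add_cancel (Nat.pos_of_ne_zero h2)]
  · simp [Piece.coeff, h2, Nat.sub_add_cancel (Nat.pos_of_ne_zero h1)]
  · simp [Piece.coeff, Nat.sub_add_cancel (Nat.pos_of_ne_zero h1),
      Nat.sub_add_cancel (Nat.pos_of_ne_zero h2)]

theorem layerPiece_injective (n : ℤ) : Function.Injective (layerPiece (s := s) n) := by
  rintro ⟨j, k⟩ ⟨j', k'⟩ h
  unfold layerPiece at h
  split_ifs at h <;> simp [Fin.ext_iff] at h ⊢ <;> (try simp at *) <;> omega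

theorem mem_cells_iff (hs : ∀ n, 0 < s n) (i : Piece s) (n : ℤ) :
    n ∈ i.cells ↔ i ∈ range (layerPiece n) := by
  constructor
  · intro h
    cases i with
    | line => exact ⟨(⟨0, hs n⟩, ⟨0, hs (n + 1)⟩), by simp [layerPiece]⟩
    | one k j =>
      obtain ⟨h1, h2⟩ : k - 1 ≤ n ∧ n < k + 1 := h
      have : k = n ∨ k = n + 1 := by omega
      rcases this with rfl | rfl
      · exact ⟨(⟨j + 1, by omega⟩, ⟨0, hs (k + 1)⟩), by simp [layerPiece]⟩
      · exact ⟨(⟨0, hs n⟩, ⟨j + 1, by omega⟩), by simp [layerPiece]⟩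
    | two k j =>
      obtain ⟨h1, h2⟩ : k ≤ n ∧ n < k + 1 := h
      obtain rfl : k = n := by omega
      refine ⟨(⟨(finProdFinEquiv.symm j).1 + 1, by omega⟩,
        ⟨(finProdFinEquiv.symm j).2 + 1, by omega⟩), ?_⟩
      simp only [layerPiece, Nat.add_eq_zero_iff, one_ne_zero, and_false, dite_false,
        Nat.add_sub_cancel, Fin.eta, Prod.mk.eta, Equiv.apply_symm_apply]
  · rintro ⟨p, rfl⟩
    unfold layerPiece
    split_ifs <;> simp [Piece.cells]

theorem coeff_eq_zero {i : Piece s} {e : LayeredEdge s} (h : e.1 ∉ i.cells) : i.coeff e = 0 := by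
  cases i with
  | line => exact absurd (mem_univ _) h
  | one k j =>
    simp only [Piece.cells, mem_Ico] at h
    simp only [Piece.coeff]
    rw [if_neg (by omega), if_neg (by omega)]
  | two k j =>
    simp only [Piece.cells, mem_Ico] at h
    simp only [Piece.coeff]
    rw [if_neg (by omega)]

theorem sum_star_coeff_layerPiece (hs : ∀ n, 0 < s n) (n : ℤ)
    (p q : Fin (s n) × Fin (s (n + 1))) :
    ∑ a, star ((layerPiece n p).coeff ⟨n, a⟩) * (layerPiece n q).coeff ⟨n, a⟩ =
      if p = q then (cellWeight s n : ℂ) else 0 := by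
  simp only [coeff_layerPiece, star_mul', Fintype.sum_prod_type]
  have h1 := sum_fourierVector (hs n) p.1.2 q.1.2
  have h2 := sum_fourierVector (hs (n + 1)) p.2.2 q.2.2
  calc _ = (∑ a : Fin (s n), star (fourierVector (s n) p.1 a) * fourierVector (s n) q.1 a) *
        ∑ b : Fin (s (n + 1)), star (fourierVector (s (n + 1)) p.2 b) *
          fourierVector (s (n + 1)) q.2 b := by
        rw [Finset.sum_mul_sum]
        exact Finset.sum_congr rfl fun a _ => Finset.sum_congr rfl fun b _ => by ring
    _ = _ := by
        rw [h1, h2]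
        simp only [Prod.ext_iff, Fin.ext_iff, cellWeight]
        split_ifs <;> simp_all

/-- On each layer the coefficients of the pieces are orthogonal. -/
theorem sum_star_coeff_mul_coeff (hs : ∀ n, 0 < s n) (n : ℤ) {i i' : Piece s}
    (hi : n ∈ i.cells) : ∑ a, star (i.coeff ⟨n, a⟩) * i'.coeff ⟨n, a⟩ =
      open Classical in if i = i' then (cellWeight s n : ℂ) else 0 := by
  classical
  by_cases hi' : n ∈ i'.cells
  · obtain ⟨p, rfl⟩ := (mem_cells_iff hs i n).1 hi
    obtain ⟨q, rfl⟩ := (mem_cells_iff hs i' n).1 hi'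
    rw [sum_star_coeff_layerPiece hs]
    simp [(layerPiece_injective n).eq_iff]
  · rw [if_neg (by rintro rfl; exact hi' hi)]
    exact Finset.sum_eq_zero fun a _ => by rw [coeff_eq_zero (i := i') hi', mul_zero]

/-- On each layer the coefficients of the pieces are complete. -/
theorem sum_coeff_mul_star_coeff (hs : ∀ n, 0 < s n) (n : ℤ) (a b : Fin (s n) × Fin (s (n + 1))) :
    ∑ p, (layerPiece n p).coeff ⟨n, a⟩ * star ((layerPiece n p).coeff ⟨n, b⟩) =
      if a = b then (cellWeight s n : ℂ) else 0 := by
  rw [show (if a = b then (cellWeight s n : ℂ) else 0) =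
    if b = a then (cellWeight s n : ℂ) else 0 by simp only [eq_comm],
    ← sum_star_coeff_layerPiece hs n b a]
  refine Finset.sum_congr rfl fun p _ => ?_
  simp only [coeff_layerPiece, fourierVector_comm _ (p.1 : ℕ), fourierVector_comm _ (p.2 : ℕ)]
  ring

end

/-! ### The Hilbert sum decomposition of `L²(Γ)` -/

section

variable {s : ℤ → ℕ}

/-- The restriction of an element of the space of the piece `i` to the `n`-th layer. -/
noncomputable abbrev pieceRestrict (hs : ∀ n, 0 < s n) (i : Piece s) (n : ℤ) :
    WeightedL2 (layeredWeight s) i.interval →ₗ[ℂ] UnitL2 :=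
  cellRestrict hs i.measurableSet_interval n

theorem pieceRestrict_eq_zero (hs : ∀ n, 0 < s n) {i : Piece s} {n : ℤ} (h : n ∉ i.cells)
    (x : WeightedL2 (layeredWeight s) i.interval) : pieceRestrict hs i n x = 0 :=
  cellRestrict_eq_zero hs _ (i.isCellUnion.notMem n h) x

theorem summable_norm_sq_pieceEmbed (hs : ∀ n, 0 < s n) (i : Piece s)
    (x : WeightedL2 (layeredWeight s) i.interval) :
    Summable fun e : LayeredEdge s => ‖i.coeff e • pieceRestrict hs i e.1 x‖ ^ 2 := by
  rw [summable_sigma_of_nonneg fun _ => by positivity]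
  refine ⟨fun n => Summable.of_finite, ?_⟩
  refine (hasSum_norm_sq_cellRestrict hs i.measurableSet_interval x).summable.congr fun n => ?_
  rw [tsum_fintype]
  by_cases h : n ∈ i.cells
  · have h1 := sum_star_coeff_mul_coeff hs n (i := i) (i' := i) h
    rw [if_pos rfl] at h1
    have h2 : ∑ a, ‖i.coeff ⟨n, a⟩‖ ^ 2 = cellWeight s n := by
      have : ∀ a, star (i.coeff ⟨n, a⟩) * i.coeff ⟨n, a⟩ = ((‖i.coeff ⟨n, a⟩‖ ^ 2 : ℝ) : ℂ) :=
        fun a => by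
          rw [RCLike.star_def, Complex.conj_mul']
          push_cast
          rfl
      simp only [this] at h1
      exact_mod_cast h1
    rw [← h2, Finset.sum_mul]
    exact Finset.sum_congr rfl fun a _ => by rw [norm_smul, mul_pow]
  · simp [pieceRestrict_eq_zero hs h]

/-- The embedding of the space of a piece into `L²(Γ)`, as a linear map. -/
noncomputable def pieceEmbedLinear (hs : ∀ n, 0 < s n) (i : Piece s) :
    WeightedL2 (layeredWeight s) i.interval →ₗ[ℂ] GraphL2 (LayeredEdge s) where
  toFun x := ⟨fun e => i.coeff e • pieceRestrict hs i e.1 x, memℓp_gen <| by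
    simpa using summable_norm_sq_pieceEmbed hs i x⟩
  map_add' x y := by
    ext1
    funext e
    exact (congrArg _ (map_add _ x y)).trans (smul_add _ _ _)
  map_smul' c x := by
    ext1
    funext e
    exact (congrArg _ (map_smul _ c x)).trans (smul_comm _ _ _)

theorem pieceEmbedLinear_apply (hs : ∀ n, 0 < s n) (i : Piece s)
    (x : WeightedL2 (layeredWeight s) i.interval) (e : LayeredEdge s) :
    pieceEmbedLinear hs i x e = i.coeff e • pieceRestrict hs i e.1 x := rfl

theorem hasSum_inner_pieceEmbedLinear (hs : ∀ n, 0 < s n) (i : Piece s)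
    (x : WeightedL2 (layeredWeight s) i.interval) (f : GraphL2 (LayeredEdge s)) :
    HasSum (fun n : ℤ => inner ℂ (pieceRestrict hs i n x) (∑ a, star (i.coeff ⟨n, a⟩) • f ⟨n, a⟩))
      (inner ℂ (pieceEmbedLinear hs i x) f) := by
  refine (lp.hasSum_inner (pieceEmbedLinear hs i x) f).sigma fun n => ?_
  convert hasSum_fintype _ using 1
  rw [inner_sum]
  refine Finset.sum_congr rfl fun a _ => ?_
  rw [pieceEmbedLinear_apply, inner_smul_left, inner_smul_right]
  rfl

theorem sum_star_coeff_smul_pieceEmbedLinear (hs : ∀ n, 0 < s n) {i i' : Piece s} {n : ℤ}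
    (hi : n ∈ i.cells) (y : WeightedL2 (layeredWeight s) i'.interval) :
    ∑ a, star (i.coeff ⟨n, a⟩) • pieceEmbedLinear hs i' y ⟨n, a⟩ =
      (open Classical in if i = i' then (cellWeight s n : ℂ) else 0) • pieceRestrict hs i' n y := by
  rw [← sum_star_coeff_mul_coeff hs n hi, Finset.sum_smul]
  refine Finset.sum_congr rfl fun a _ => ?_
  rw [pieceEmbedLinear_apply, smul_smul]

theorem inner_pieceEmbedLinear_self (hs : ∀ n, 0 < s n) (i : Piece s)
    (x y : WeightedL2 (layeredWeight s) i.interval) :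
    inner ℂ (pieceEmbedLinear hs i x) (pieceEmbedLinear hs i y) = inner ℂ x y := by
  refine (hasSum_inner_pieceEmbedLinear hs i x _).unique
    ((hasSum_inner_cellRestrict hs i.measurableSet_interval x y).congr_fun fun n => ?_)
  by_cases h : n ∈ i.cells
  · rw [sum_star_coeff_smul_pieceEmbedLinear hs h, if_pos rfl, inner_smul_right]
  · rw [pieceRestrict_eq_zero hs h x]
    simp

/-- The isometric embedding of the space of a piece into `L²(Γ)`. -/
noncomputable def pieceEmbed (hs : ∀ n, 0 < s n) (i : Piece s) :
    WeightedL2 (layeredWeight s) i.interval →ₗᵢ[ℂ] GraphL2 (LayeredEdge s) :=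
  (pieceEmbedLinear hs i).isometryOfInner (inner_pieceEmbedLinear_self hs i)

theorem pieceEmbed_apply (hs : ∀ n, 0 < s n) (i : Piece s)
    (x : WeightedL2 (layeredWeight s) i.interval) (e : LayeredEdge s) :
    pieceEmbed hs i x e = i.coeff e • pieceRestrict hs i e.1 x := rfl

theorem orthogonalFamily_pieceEmbed (hs : ∀ n, 0 < s n) :
    OrthogonalFamily ℂ (fun i : Piece s => WeightedL2 (layeredWeight s) i.interval)
      (pieceEmbed hs) := by
  intro i i' hii x y
  refine (hasSum_inner_pieceEmbedLinear hs i x (pieceEmbed hs i' y)).unique ?_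
  refine hasSum_zero.congr_fun fun n => ?_
  by_cases h : n ∈ i.cells
  · have := sum_star_coeff_smul_pieceEmbedLinear hs h y
    rw [if_neg hii, zero_smul] at this
    exact (congrArg _ this).trans (inner_zero_right _)
  · rw [pieceRestrict_eq_zero hs h x, inner_zero_left]

/-- Fourier inversion on the `n`-th layer. -/
theorem cellWeight_smul_eq_sum (hs : ∀ n, 0 < s n) {M : Type*} [AddCommGroup M] [Module ℂ M]
    (n : ℤ) (φ : Fin (s n) × Fin (s (n + 1)) → M) (a : Fin (s n) × Fin (s (n + 1))) :
    ∑ p, (layerPiece n p).coeff ⟨n, a⟩ • ∑ b, star ((layerPiece n p).coeff ⟨n, b⟩) • φ b =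
      (cellWeight s n : ℂ) • φ a := by
  simp only [Finset.smul_sum, smul_smul]
  rw [Finset.sum_comm]
  simp only [← Finset.sum_smul, sum_coeff_mul_star_coeff hs n, ite_smul, zero_smul]
  simp

theorem isHilbertSum_pieceEmbed (hs : ∀ n, 0 < s n) :
    IsHilbertSum ℂ (fun i : Piece s => WeightedL2 (layeredWeight s) i.interval)
      (pieceEmbed hs) := by
  refine .mk (orthogonalFamily_pieceEmbed hs) ?_
  rw [top_le_iff, Submodule.topologicalClosure_eq_top_iff, Submodule.eq_bot_iff]
  intro f hf
  have hzero : ∀ (i : Piece s) (n : ℤ), n ∈ i.cells →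
      ∑ a, star (i.coeff ⟨n, a⟩) • f ⟨n, a⟩ = 0 := by
    intro i n hn
    refine ext_inner_left ℂ fun h => ?_
    rw [inner_zero_right]
    have h1 : inner ℂ (pieceEmbedLinear hs i (cellExtend s i.interval n h)) f = 0 :=
      hf _ (Submodule.mem_iSup_of_mem i ⟨cellExtend s i.interval n h, rfl⟩)
    have h2 := hasSum_inner_pieceEmbedLinear hs i (cellExtend s i.interval n h) f
    have hR : ∀ k, pieceRestrict hs i k (cellExtend s i.interval n h) = if k = n then h else 0 :=
      fun k => cellRestrict_cellExtend hs _ (i.isCellUnion.mem n hn) k h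
    have h3 := h2.unique (hasSum_single n fun k hk => by simp [hR, hk])
    rw [hR, if_pos rfl, h1] at h3
    exact h3.symm
  ext1
  funext e
  obtain ⟨n, a⟩ := e
  have h1 := cellWeight_smul_eq_sum hs n (fun b => f ⟨n, b⟩) a
  simp only [hzero _ n ((mem_cells_iff hs _ n).2 (mem_range_self _)), smul_zero,
    Finset.sum_const_zero] at h1
  have h2 : (cellWeight s n : ℂ) ≠ 0 := by exact_mod_cast (cellWeight_pos hs n).ne'
  exact (smul_eq_zero.1 h1.symm).resolve_left h2

theorem symm_apply_edge (hs : ∀ n, 0 < s n)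
    (w : lp (fun i : Piece s => WeightedL2 (layeredWeight s) i.interval) 2) (n : ℤ)
    (a : Fin (s n) × Fin (s (n + 1))) :
    (isHilbertSum_pieceEmbed hs).linearIsometryEquiv.symm w ⟨n, a⟩ =
      ∑ p, (layerPiece n p).coeff ⟨n, a⟩ •
        pieceRestrict hs (layerPiece n p) n (w (layerPiece n p)) := by
  have h := (isHilbertSum_pieceEmbed hs).hasSum_linearIsometryEquiv_symm w
  let ev : GraphL2 (LayeredEdge s) →ₗ[ℂ] UnitL2 :=
    { toFun := fun f => f ⟨n, a⟩
      map_add' := fun _ _ => rfl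
      map_smul' := fun _ _ => rfl }
  have hev : Continuous ev := AddMonoidHomClass.continuous_of_bound ev 1 fun f => by
    rw [one_mul]; exact lp.norm_apply_le_norm two_ne_zero f _
  have h1 := h.map ev hev
  rw [← (layerPiece_injective (s := s) n).hasSum_iff] at h1
  · exact h1.unique (hasSum_fintype _)
  · intro i hi
    have : i.coeff ⟨n, a⟩ = 0 := coeff_eq_zero fun h => hi ((mem_cells_iff hs i n).1 h)
    change pieceEmbed hs i (w i) ⟨n, a⟩ = 0
    rw [pieceEmbed_apply, this, zero_smul]

end

/-! ### The Kirchhoff Laplacian in terms of the pieces -/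

section

variable {s : ℤ → ℕ}

theorem sum_src (n : ℤ) (a : Fin (s n)) (φ : LayeredEdge s → ℂ) :
    ∑ e ∈ (LayeredEdge.finite_src (s := s) ⟨n, a⟩).toFinset, φ e =
      ∑ b : Fin (s (n + 1)), φ ⟨n, a, b⟩ := by
  symm
  refine Finset.sum_bij (fun b _ => ⟨n, a, b⟩) (fun b _ => ?_) (fun b _ b' _ h => ?_)
    (fun e he => ?_) (fun _ _ => rfl)
  · simp [LayeredEdge.src]
  · simpa using h
  · obtain ⟨m, a', b⟩ := e
    simp only [Finite.mem_toFinset, mem_ofPred_eq, LayeredEdge.src, Sigma.mk.injEq] at he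
    obtain ⟨rfl, he⟩ := he
    obtain rfl := eq_of_heq he
    exact ⟨b, Finset.mem_univ _, rfl⟩

theorem sum_tgt (n : ℤ) (b : Fin (s (n + 1))) (φ : LayeredEdge s → ℂ) :
    ∑ e ∈ (LayeredEdge.finite_tgt (s := s) ⟨n + 1, b⟩).toFinset, φ e =
      ∑ a : Fin (s n), φ ⟨n, a, b⟩ := by
  symm
  refine Finset.sum_bij (fun a _ => ⟨n, a, b⟩) (fun b _ => ?_) (fun b _ b' _ h => ?_)
    (fun e he => ?_) (fun _ _ => rfl)
  · simp [LayeredEdge.tgt]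
  · simpa using h
  · obtain ⟨m, a, b'⟩ := e
    simp only [Finite.mem_toFinset, mem_ofPred_eq, LayeredEdge.tgt, Sigma.mk.injEq] at he
    obtain ⟨h1, he⟩ := he
    obtain rfl : m = n := by omega
    obtain rfl := eq_of_heq he
    exact ⟨a, Finset.mem_univ _, rfl⟩

/-- Boundary values on the edges which satisfy the Kirchhoff conditions. -/
structure IsKirchhoff (γ : LayeredEdge s → Fin 4 → ℂ) (F : LayeredVertex s → ℂ) : Prop where
  src : ∀ n a b, γ ⟨n, a, b⟩ 0 = F ⟨n, a⟩
  tgt : ∀ n a b, γ ⟨n, a, b⟩ 1 = F ⟨n + 1, b⟩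
  flux : ∀ n a, ∑ b, γ ⟨n + 1, a, b⟩ 2 = ∑ c, γ ⟨n, c, a⟩ 3

/-- The Kirchhoff Laplacian in terms of the boundary values on its edges. The square summability
of the derivative is automatic, by the interpolation estimate on the unit interval. -/
theorem mem_layeredKirchhoffGraph_iff (f g : GraphL2 (LayeredEdge s)) :
    (f, g) ∈ kirchhoffGraph LayeredEdge.src LayeredEdge.tgt (LayeredEdge.finite_src (s := s))
        LayeredEdge.finite_tgt ↔
      ∃ γ F, IsKirchhoff γ F ∧ ∀ e, (f e, g e, γ e) ∈ unitTriples := by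
  constructor
  · rintro ⟨u, u', u'', F, h, h1, h2, h3, h4, h5, h6, h7⟩
    refine ⟨fun e => ![u e 0, u e 1, u' e 0, u' e 1], F, ⟨fun n a b => (h6 ⟨n, a, b⟩).1,
      fun n a b => (h6 ⟨n, a, b⟩).2, fun n a => ?_⟩,
      fun e => ⟨u e, u' e, u'' e, h1 e, h2 e, h3 e, h5 e, rfl⟩⟩
    have := h7 ⟨n + 1, a⟩
    rw [sum_src, sum_tgt n a fun e => -u' e 1, Finset.sum_neg_distrib] at this
    exact sub_eq_zero.1 ((sub_eq_add_neg _ _).trans this)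
  · rintro ⟨γ, F, ⟨k1, k2, k3⟩, hT⟩
    choose u u' u'' h1 h2 h3 h4 h5 using hT
    obtain ⟨C, hC, hb⟩ := exists_deriv_bound
    choose h hh hn using fun e => hb (f e) (g e) (u e) (u' e) (u'' e) (h1 e) (h2 e) (h3 e) (h4 e)
    have hmem : Memℓp h 2 := by
      refine memℓp_gen ?_
      have h2pos : 0 < (2 : ENNReal).toReal := by simp
      have hf := (lp.memℓp f).summable h2pos
      have hg := (lp.memℓp g).summable h2pos
      simp only [ENNReal.toReal_ofNat, Real.rpow_ofNat] at hf hg ⊢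
      refine .of_nonneg_of_le (fun e => by positivity) (fun e => ?_)
        ((hf.add hg).mul_left (2 * C ^ 2))
      have a1 := pow_le_pow_left₀ (norm_nonneg _) (hn e) 2
      nlinarith [mul_nonneg (sq_nonneg C) (sq_nonneg (‖f e‖ - ‖g e‖))]
    simp only at h5
    refine ⟨u, u', u'', F, ⟨h, hmem⟩, h1, h2, h3, hh, h4, fun e => ⟨?_, ?_⟩, fun v => ?_⟩
    · simpa [h5, LayeredEdge.src] using k1 e.1 e.2.1 e.2.2
    · simpa [h5, LayeredEdge.tgt] using k2 e.1 e.2.1 e.2.2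
    · obtain ⟨n, a⟩ := v
      obtain ⟨n, rfl⟩ : ∃ m, n = m + 1 := ⟨n - 1, by omega⟩
      rw [sum_src, sum_tgt n a fun e => -u' e 1, Finset.sum_neg_distrib, ← sub_eq_add_neg,
        sub_eq_zero]
      simpa [h5] using k3 n a

theorem notMem_cells_succ {n : ℤ} {p : Fin (s n) × Fin (s (n + 1))}
    (h : p.1.val ≠ 0) : n + 1 ∉ (layerPiece n p).cells := by
  unfold layerPiece
  rw [dif_neg h]
  split_ifs <;> simp [Piece.cells]

theorem notMem_cells_pred {n : ℤ} {p : Fin (s (n + 1)) × Fin (s (n + 1 + 1))}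
    (h : p.2.val ≠ 0) : n ∉ (layerPiece (n + 1) p).cells := by
  unfold layerPiece
  simp only [h, dite_false]
  split_ifs <;> simp [Piece.cells]

theorem layerPiece_eq_succ {n : ℤ} {j : Fin (s n)} {k : Fin (s (n + 1))} {l : Fin (s (n + 1 + 1))}
    (hj : j.val = 0) (hl : l.val = 0) : layerPiece n (j, k) = layerPiece (n + 1) (k, l) := by
  simp [layerPiece, hj, hl]

theorem sum_fourierVector_fin (hs : ∀ n, 0 < s n) (n : ℤ) (k : Fin (s n)) :
    ∑ a : Fin (s n), fourierVector (s n) k a = if k.val = 0 then (s n : ℂ) else 0 := by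
  have := sum_fourierVector (hs n) (hs n) k.2
  simpa [eq_comm] using this

theorem sum_eq_of_val_ne_zero {m : ℕ} (hm : 0 < m) {φ : Fin m → ℂ}
    (h : ∀ k, k.val ≠ 0 → φ k = 0) : ∑ k, φ k = φ ⟨0, hm⟩ :=
  Fintype.sum_eq_single _ fun k hk => h k fun h0 => hk (Fin.ext h0)

/-- Matching boundary values of all the pieces combine to boundary values on the edges which
satisfy the Kirchhoff conditions. -/
theorem exists_isKirchhoff (hs : ∀ n, 0 < s n) {γ : Piece s → ℤ → Fin 4 → ℂ}
    (hγ : ∀ i, IsMatched s i.cells (γ i)) :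
    ∃ F, IsKirchhoff (fun e => ∑ p, (layerPiece e.1 p).coeff e • γ (layerPiece e.1 p) e.1) F := by
  have hval : ∀ n (a : Fin (s n)) (b : Fin (s (n + 1))) (i : Fin 4),
      (∑ p, (layerPiece n p).coeff ⟨n, a, b⟩ • γ (layerPiece n p) n) i =
        ∑ j : Fin (s n), ∑ k : Fin (s (n + 1)),
          fourierVector (s n) j a * fourierVector (s (n + 1)) k b *
            γ (layerPiece n (j, k)) n i := by
    intro n a b i
    simp only [Finset.sum_apply, Pi.smul_apply, smul_eq_mul, coeff_layerPiece,
      Fintype.sum_prod_type]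
  -- A piece which is nonconstant on the right end of the layer has a Dirichlet condition on the
  -- left end, and vice versa.
  have h0 : ∀ n (j : Fin (s n)) (k : Fin (s (n + 1))), k.val ≠ 0 →
      γ (layerPiece n (j, k)) n 0 = 0 := by
    intro n j k hk
    obtain ⟨n, rfl⟩ : ∃ m, n = m + 1 := ⟨n - 1, by omega⟩
    rw [← (hγ _).value n, (hγ _).eq_zero n (notMem_cells_pred hk)]
    rfl
  have h1 : ∀ n (j : Fin (s n)) (k : Fin (s (n + 1))), j.val ≠ 0 →
      γ (layerPiece n (j, k)) n 1 = 0 := by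
    intro n j k hj
    rw [(hγ _).value n, (hγ _).eq_zero _ (notMem_cells_succ hj)]
    rfl
  refine ⟨fun v => ∑ j : Fin (s v.1), fourierVector (s v.1) j v.2 *
    γ (layerPiece v.1 (j, ⟨0, hs (v.1 + 1)⟩)) v.1 0, fun n a b => ?_, fun n a b => ?_,
    fun n a => ?_⟩
  · rw [hval]
    refine Finset.sum_congr rfl fun j _ => ?_
    rw [sum_eq_of_val_ne_zero (hs (n + 1)) fun k hk => by rw [h0 n j k hk, mul_zero]]
    simp
  · rw [hval, sum_eq_of_val_ne_zero (hs n) fun j hj =>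
      Finset.sum_eq_zero fun k _ => by rw [h1 n j k hj, mul_zero]]
    refine Finset.sum_congr rfl fun k _ => ?_
    rw [(hγ _).value n, layerPiece_eq_succ (l := ⟨0, hs (n + 1 + 1)⟩) rfl rfl]
    simp
  -- At each vertex only the pieces which live on both neighbouring layers contribute to the fluxes.
  · have hl : ∑ b, (∑ p, (layerPiece (n + 1) p).coeff ⟨n + 1, a, b⟩ •
        γ (layerPiece (n + 1) p) (n + 1)) 2 = ∑ k : Fin (s (n + 1)), fourierVector (s (n + 1)) k a *
          (s (n + 1 + 1) * γ (layerPiece (n + 1) (k, ⟨0, hs (n + 1 + 1)⟩)) (n + 1) 2) := by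
      simp only [hval]
      rw [Finset.sum_comm]
      refine Finset.sum_congr rfl fun k _ => ?_
      rw [Finset.sum_comm]
      have : ∀ l : Fin (s (n + 1 + 1)), ∑ b : Fin (s (n + 1 + 1)),
          fourierVector (s (n + 1)) k a * fourierVector (s (n + 1 + 1)) l b *
            γ (layerPiece (n + 1) (k, l)) (n + 1) 2 =
          fourierVector (s (n + 1)) k a * (if l.val = 0 then (s (n + 1 + 1) : ℂ) else 0) *
            γ (layerPiece (n + 1) (k, l)) (n + 1) 2 := fun l => by
        rw [← sum_fourierVector_fin hs, Finset.mul_sum, Finset.sum_mul]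
      simp only [this]
      rw [sum_eq_of_val_ne_zero (hs (n + 1 + 1)) fun l hl => by simp [hl]]
      simp [mul_assoc]
    have hr : ∑ c, (∑ p, (layerPiece n p).coeff ⟨n, c, a⟩ • γ (layerPiece n p) n) 3 =
        ∑ k : Fin (s (n + 1)), fourierVector (s (n + 1)) k a *
          (s n * γ (layerPiece n (⟨0, hs n⟩, k)) n 3) := by
      simp only [hval]
      rw [Finset.sum_comm]
      have : ∀ j : Fin (s n), ∑ c : Fin (s n), ∑ k : Fin (s (n + 1)),
          fourierVector (s n) j c * fourierVector (s (n + 1)) k a *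
            γ (layerPiece n (j, k)) n 3 =
          ∑ k : Fin (s (n + 1)), (if j.val = 0 then (s n : ℂ) else 0) *
            (fourierVector (s (n + 1)) k a * γ (layerPiece n (j, k)) n 3) := fun j => by
        rw [Finset.sum_comm]
        refine Finset.sum_congr rfl fun k _ => ?_
        rw [← sum_fourierVector_fin hs, Finset.sum_mul]
        exact Finset.sum_congr rfl fun c _ => mul_assoc _ _ _
      simp only [this]
      rw [sum_eq_of_val_ne_zero (hs n) fun j hj => by simp [hj]]
      refine Finset.sum_congr rfl fun k _ => ?_
      simp only [if_true]
      ring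
    refine hl.trans (Eq.trans (Finset.sum_congr rfl fun k _ => ?_) hr.symm)
    have e := layerPiece_eq_succ (s := s) (n := n) (j := ⟨0, hs n⟩) (k := k)
      (l := ⟨0, hs (n + 1 + 1)⟩) rfl rfl
    have hf := (hγ (layerPiece n (⟨0, hs n⟩, k))).flux n
      ((mem_cells_iff hs _ _).2 (mem_range_self _)) (by
        rw [e]; exact (mem_cells_iff hs _ _).2 (mem_range_self _))
    have hsn : (s (n + 1) : ℂ) ≠ 0 := by exact_mod_cast (hs (n + 1)).ne'
    rw [← e]
    congr 1
    refine mul_left_cancel₀ hsn ?_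
    simp only [cellWeight] at hf
    push_cast at hf
    linear_combination -hf

/-- The coefficients of a piece on two neighbouring layers have the same averages at the vertices
between them. -/
theorem sum_coeff_left_eq_sum_coeff_right (hs : ∀ n, 0 < s n) (i : Piece s) (n : ℤ)
    (b : Fin (s (n + 1))) :
    (cellWeight s n : ℂ)⁻¹ * ∑ a, star (i.coeff ⟨n, a, b⟩) =
      (cellWeight s (n + 1) : ℂ)⁻¹ * ∑ c, star (i.coeff ⟨n + 1, b, c⟩) := by
  have hs' : ∀ m, (s m : ℂ) ≠ 0 := fun m => by exact_mod_cast (hs m).ne'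
  have hl : ∀ (j : Fin (s n)) k, ∑ a, star ((layerPiece n (j, k)).coeff ⟨n, a, b⟩) =
      (if j.val = 0 then (s n : ℂ) else 0) * star (fourierVector (s (n + 1)) k b) := by
    intro j k
    have := congrArg star (sum_fourierVector_fin hs n j)
    rw [star_sum] at this
    simp only [coeff_layerPiece, star_mul', ← Finset.sum_mul]
    rw [this]
    split_ifs <;> simp
  have hr : ∀ k (l : Fin (s (n + 1 + 1))),
      ∑ c, star ((layerPiece (n + 1) (k, l)).coeff ⟨n + 1, b, c⟩) =
      star (fourierVector (s (n + 1)) k b) * (if l.val = 0 then (s (n + 1 + 1) : ℂ) else 0) := by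
    intro k l
    have := congrArg star (sum_fourierVector_fin hs (n + 1 + 1) l)
    rw [star_sum] at this
    simp only [coeff_layerPiece, star_mul', ← Finset.mul_sum]
    rw [this]
    split_ifs <;> simp
  have hzl : n ∉ i.cells → ∑ a, star (i.coeff ⟨n, a, b⟩) = 0 := fun h =>
    Finset.sum_eq_zero fun a _ => by rw [coeff_eq_zero h, star_zero]
  have hzr : n + 1 ∉ i.cells → ∑ c, star (i.coeff ⟨n + 1, b, c⟩) = 0 := fun h =>
    Finset.sum_eq_zero fun c _ => by rw [coeff_eq_zero h, star_zero]
  by_cases h : n ∈ i.cells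
  · obtain ⟨⟨j, k⟩, rfl⟩ := (mem_cells_iff hs i n).1 h
    by_cases hj : j.val = 0
    · rw [hl, if_pos hj, layerPiece_eq_succ (l := ⟨0, hs (n + 1 + 1)⟩) hj rfl, hr, if_pos rfl]
      simp only [cellWeight]
      have a0 := hs' n
      have a1 := hs' (n + 1)
      have a2 := hs' (n + 1 + 1)
      push_cast
      field_simp
    · rw [hl, if_neg hj, hzr (notMem_cells_succ hj)]
      simp
  · rw [hzl h]
    by_cases h' : n + 1 ∈ i.cells
    · obtain ⟨⟨k, l⟩, rfl⟩ := (mem_cells_iff hs i (n + 1)).1 h'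
      have hl0 : l.val ≠ 0 := fun hl0 => h <| by
        rw [← layerPiece_eq_succ (j := ⟨0, hs n⟩) rfl hl0]
        exact (mem_cells_iff hs _ _).2 (mem_range_self _)
      rw [hr, if_neg hl0]
      simp
    · rw [hzr h']
      simp

/-- Where a piece lives on two neighbouring layers, its coefficients depend only on the common
vertex. -/
theorem exists_coeff_eq (hs : ∀ n, 0 < s n) {i : Piece s} {n : ℤ} (h : n ∈ i.cells)
    (h' : n + 1 ∈ i.cells) : ∃ c : Fin (s (n + 1)) → ℂ,
      (∀ a b, i.coeff ⟨n, a, b⟩ = c b) ∧ ∀ b d, i.coeff ⟨n + 1, b, d⟩ = c b := by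
  obtain ⟨⟨j, k⟩, rfl⟩ := (mem_cells_iff hs i n).1 h
  have hj : j.val = 0 := by
    by_contra hj
    exact notMem_cells_succ hj h'
  refine ⟨fun b => fourierVector (s (n + 1)) k b, fun a b => ?_, fun b d => ?_⟩
  · simp [coeff_layerPiece, hj]
  · rw [layerPiece_eq_succ (l := ⟨0, hs (n + 1 + 1)⟩) hj rfl]
    simp [coeff_layerPiece]

/-- The Fourier coefficients of boundary values satisfying the Kirchhoff conditions match. -/
theorem isMatched_of_isKirchhoff (hs : ∀ n, 0 < s n) {γ : LayeredEdge s → Fin 4 → ℂ}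
    {F : LayeredVertex s → ℂ} (hγ : IsKirchhoff γ F) (i : Piece s) :
    IsMatched s i.cells fun n =>
      (cellWeight s n : ℂ)⁻¹ • ∑ a, star (i.coeff ⟨n, a⟩) • γ ⟨n, a⟩ where
  eq_zero m hm := by
    simp [coeff_eq_zero (i := i) (e := ⟨m, _⟩) hm]
  value n := by
    have key := sum_coeff_left_eq_sum_coeff_right hs i n
    simp only [Pi.smul_apply, Finset.sum_apply, smul_eq_mul, Fintype.sum_prod_type, hγ.src, hγ.tgt,
      ← Finset.sum_mul]
    rw [Finset.sum_comm]
    simp only [← Finset.sum_mul]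
    rw [Finset.mul_sum, Finset.mul_sum]
    exact Finset.sum_congr rfl fun b _ => by rw [← mul_assoc, key b, mul_assoc]
  flux n h h' := by
    obtain ⟨c, c1, c2⟩ := exists_coeff_eq hs h h'
    have hω : ∀ m, (cellWeight s m : ℂ) ≠ 0 := fun m => by
      exact_mod_cast (cellWeight_pos hs m).ne'
    simp only [Pi.smul_apply, Finset.sum_apply, smul_eq_mul, Fintype.sum_prod_type, c1, c2,
      mul_inv_cancel_left₀ (hω _)]
    rw [Finset.sum_comm]
    simp only [← Finset.mul_sum, hγ.flux]

/-- The decomposition of `L²(Γ)` carries the graph of the Kirchhoff Laplacian to the graph of the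
direct sum. -/
theorem mem_kirchhoffGraph_iff_directSum (hs : ∀ n, 0 < s n)
    (w z : lp (fun i : Piece s => WeightedL2 (layeredWeight s) i.interval) 2) :
    ((isHilbertSum_pieceEmbed hs).linearIsometryEquiv.symm w,
      (isHilbertSum_pieceEmbed hs).linearIsometryEquiv.symm z) ∈
        kirchhoffGraph LayeredEdge.src LayeredEdge.tgt (LayeredEdge.finite_src (s := s))
          LayeredEdge.finite_tgt ↔
      ∀ i, (w i, z i) ∈ sturmLiouvilleGraph (layeredWeight s) i.interval i.boundary := by
  rw [mem_layeredKirchhoffGraph_iff]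
  have hrec : ∀ (w : lp (fun i : Piece s => WeightedL2 (layeredWeight s) i.interval) 2)
      (i : Piece s) (n : ℤ), n ∈ i.cells → pieceRestrict hs i n (w i) =
        (cellWeight s n : ℂ)⁻¹ • ∑ a, star (i.coeff ⟨n, a⟩) •
          (isHilbertSum_pieceEmbed hs).linearIsometryEquiv.symm w ⟨n, a⟩ := by
    intro w i n hn
    obtain ⟨q, rfl⟩ := (mem_cells_iff hs i n).1 hn
    simp only [symm_apply_edge, Finset.smul_sum, smul_smul]
    rw [Finset.sum_comm]
    simp only [← Finset.sum_smul, ← Finset.mul_sum, sum_star_coeff_layerPiece hs]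
    have hω : (cellWeight s n : ℂ) ≠ 0 := by exact_mod_cast (cellWeight_pos hs n).ne'
    simp [hω]
  constructor
  · rintro ⟨γ, F, hγ, hT⟩ i
    refine (mem_sturmLiouvilleGraph_iff hs i.isCellUnion _ _).2
      ⟨_, isMatched_of_isKirchhoff hs hγ i, fun n hn => ?_⟩
    have h1 := unitTriples.smul_mem (cellWeight s n : ℂ)⁻¹ (unitTriples.sum_mem
      (t := Finset.univ) fun a _ => unitTriples.smul_mem (star (i.coeff ⟨n, a⟩)) (hT ⟨n, a⟩))
    have e1 := hrec w i n hn
    have e2 := hrec z i n hn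
    convert h1 using 1
    refine Prod.ext ?_ (Prod.ext ?_ ?_)
    · simpa [Prod.fst_sum] using e1
    · simpa [Prod.fst_sum, Prod.snd_sum] using e2
    · simp [Prod.snd_sum]
  · intro h
    choose γ hγ hT using fun i => (mem_sturmLiouvilleGraph_iff hs i.isCellUnion _ _).1 (h i)
    obtain ⟨F, hF⟩ := exists_isKirchhoff hs hγ
    refine ⟨_, F, hF, fun e => ?_⟩
    obtain ⟨n, a⟩ := e
    have h1 := unitTriples.sum_mem (t := Finset.univ) fun p _ =>
      unitTriples.smul_mem ((layerPiece n p).coeff ⟨n, a⟩)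
        (hT (layerPiece n p) n ((mem_cells_iff hs _ _).2 (mem_range_self _)))
    convert h1 using 1
    refine Prod.ext ?_ (Prod.ext ?_ ?_)
    · simpa [Prod.fst_sum] using symm_apply_edge hs w n a
    · simpa [Prod.fst_sum, Prod.snd_sum] using symm_apply_edge hs z n a
    · simp [Prod.snd_sum]

/-! ### Unitary equivalence -/

theorem UnitarilyEquivalent.of_graph {E F : Type*} [NormedAddCommGroup E] [InnerProductSpace ℂ E]
    [NormedAddCommGroup F] [InnerProductSpace ℂ F] {A : E →ₗ.[ℂ] E} {B : F →ₗ.[ℂ] F}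
    (U : E ≃ₗᵢ[ℂ] F) (h : ∀ x y, (x, y) ∈ A.graph ↔ (U x, U y) ∈ B.graph) :
    UnitarilyEquivalent A B := by
  refine ⟨U, fun x => ⟨fun hx => ?_, fun hx => ?_⟩, fun x y hxy => ?_⟩
  · exact LinearPMap.mem_domain_of_mem_graph ((h _ _).1 (A.mem_graph ⟨x, hx⟩))
  · refine LinearPMap.mem_domain_of_mem_graph (y := U.symm (B ⟨U x, hx⟩)) ((h _ _).2 ?_)
    rw [LinearIsometryEquiv.apply_symm_apply]
    exact B.mem_graph ⟨U x, hx⟩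
  · have h1 := (h _ _).1 (A.mem_graph x)
    rw [hxy] at h1
    exact LinearPMap.mem_graph_snd_inj' _ h1 (B.mem_graph y) rfl

end

theorem proposition5p2 (s : ℤ → ℕ) (hs : ∀ n, 0 < s n) :
    IsSelfAdjoint (lineOperator s) ∧
      UnitarilyEquivalent (layeredLaplacian s)
        (directSumOperator fun i : Piece s => i.operator) := by
  refine ⟨lineOperator_isSelfAdjoint hs, ?_⟩
  refine .of_graph (isHilbertSum_pieceEmbed hs).linearIsometryEquiv fun f g => ?_
  have h1 : (layeredLaplacian s).graph = kirchhoffGraph LayeredEdge.src LayeredEdge.tgt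
      LayeredEdge.finite_src LayeredEdge.finite_tgt :=
    Submodule.toLinearPMap_graph_eq _ (kirchhoffGraph_singleValued _ _ _ _)
  have h2 : (directSumOperator fun i : Piece s => i.operator).graph =
      directSumGraph fun i : Piece s => i.operator :=
    Submodule.toLinearPMap_graph_eq _ (directSumGraph_singleValued _)
  rw [h1, h2]
  have h3 := mem_kirchhoffGraph_iff_directSum hs
    ((isHilbertSum_pieceEmbed hs).linearIsometryEquiv f)
    ((isHilbertSum_pieceEmbed hs).linearIsometryEquiv g)
  simp only [LinearIsometryEquiv.symm_apply_apply] at h3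
  rw [h3]
  exact forall_congr' fun i => by rw [← i.operator_graph hs]
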